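/- Let $n,k\ge 1$ be integers and let $q>0$, $q\neq 1$, be real. For a Young diagram $\lambda=(\lambda_1\ge\dots\ge\lambda_n\ge 0)$ contained in the $n\times k$ rectangle ($n$ rows, $k$ columns), let $\bar\lambda$ be the complement of $\lambda$ in the rectangle (rotated by $180^\circ$), $\bar\lambda'$ its conjugate, and $a_i=\lambda_i+n-i$ for $1\le i\le n$. For a diagram $\mu$ with at most $m$ rows let $s_\mu(x_1,\dots,x_m)$ be the Schur polynomial (the sum over semistandard Young tableaux of shape $\mu$ with entries in $\{1,\dots,m\}$), i.e. the character of the irreducible $GL_m$-representation $V_{GL_m}(\mu)$; let $\|\mu\|=\sum_{i=1}^m (i-1)\mu_i$ and $$\dim_q V_{GL_m}(\mu)=\sum_{u\in\mathbb{Z}_{\ge0}^{m-1}}q^{u_1+\dots+u_{m-1}}\dim V(\mu)_{\mu-\sum_i u_i\alpha_i},$$ where $\alpha_i$ are the simple roots and the dimension of a weight subspace is the coefficient of that weight in the character. Consider $$\mu_{n,k}(\lambda|q)=\frac{q^{\|\lambda\|}\dim_q V_{GL_n}(\lambda)\; q^{\|\bar\lambda'\|}\dim_q V_{GL_k}(\bar\lambda')}{\prod_{i=1}^n\prod_{j=1}^k(q^{i-1}+q^{j-1})},$$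 $$\mu_{n,k}(\lambda|q,q^{-1})=\frac{q^{\|\lambda\|}\dim_q V_{GL_n}(\lambda)\; q^{-\|\bar\lambda'\|}\dim_{1/q} V_{GL_k}(\bar\lambda')}{\prod_{i=1}^n\prod_{j=1}^k(q^{i-1}+q^{1-j})}.$$ With $[m]_q=\frac{1-q^m}{1-q}$, let $\binom{N}{a}_q$ be the $q$-binomial coefficient. For $p>0$ and $0\le j\le N$ let $\tilde K_j(x;p,N)$ be the $q$-Krawtchouk polynomial $$K_j(q^{-x};p,N;q)={}_3\phi_2\left(q^{-j},\,q^{-x},\,-pq^{j};\,q^{-N},\,0;\,q,\,q\right)$$ divided by its norm with respect to the weight $\binom{N}{x}_q p^{-x}q^{\binom x2-xN}$ on $x=0,\dots,N$. Put $N=n+k-1$. (1) The measure $\mu_{n,k}(\cdot|q)$ is the specialization $x_i=q^{i-1}$, $y_j=q^{j-1}$ of $$\frac{s_\lambda(x_1,\dots,x_n)\,s_{\bar\lambda'}(y_1,\dots,y_k)}{\prod_{i=1}^n\prod_{j=1}^k(x_i+y_j)},$$ it is a probability measure on the diagrams in the $n\times k$ rectangle, and it is the $q$-Krawtchouk polynomial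 ensemble with $p=q^{1-2n}$: $$\mu_{n,k}(\lambda|q)=\det\left(\sqrt{W(a_i)W(a_j)}\sum_{l=0}^{n-1}\tilde K_l(a_i;p,N)\,\tilde K_l(a_j;p,N)\right)_{i,j=1}^n,\qquad W(a)=q^{\binom a2+a(n-k)}\binom{n+k-1}{a}_q,$$ where $\sum_{a=0}^{N}W(a)\tilde K_j(a;p,N)\tilde K_l(a;p,N)=\delta_{jl}$ for $0\le j,l\le N$. (2) The measure $\mu_{n,k}(\cdot|q,q^{-1})$ is the specialization $x_i=q^{i-1}$, $y_j=q^{1-j}$ of the same expression, it is a probability measure on the diagrams in the $n\times k$ rectangle, and the determinantal formula and the orthonormality relations of (1) hold for it with $p=q^{2-2n-k}$ and with $W$ replaced by $\hat W(a)=q^{\binom a2+a(n-1)}\binom{n+k-1}{a}_q$. -/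

import Mathlib

namespace SkewHowe

noncomputable section

/-! ### Young diagrams in a box

Rows, columns and tableau entries are numbered from `0`, as in Mathlib. -/

/-- The Young diagrams contained in the rectangle with `n` rows and `k` columns. -/
def boxDiagrams (n k : ℕ) : Set YoungDiagram :=
  {lam | ∀ c ∈ lam, c.1 < n ∧ c.2 < k}

/-- The complement of `lam` in the rectangle with `n` rows and `k` columns, rotated by 180 degrees
so that it is again a Young diagram. -/
def boxComplement (n k : ℕ) (lam : YoungDiagram) : YoungDiagram where
  cells := (Finset.range n ×ˢ Finset.range k).filter
    (fun c => (n - 1 - c.1, k - 1 - c.2) ∉ lam)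
  isLowerSet := by
    rintro ⟨i, j⟩ ⟨i', j'⟩ hle h
    have h1 : i' ≤ i := hle.1
    have h2 : j' ≤ j := hle.2
    simp only [Finset.coe_filter, Finset.mem_product, Finset.mem_range, Set.mem_ofPred_eq] at h ⊢
    refine ⟨⟨by omega, by omega⟩, fun hmem => h.2 ?_⟩
    exact lam.up_left_mem (by omega) (by omega) hmem

/-- The complement conjugate diagram of `lam` in the `n × k` rectangle; it lies in the `k × n`
rectangle. -/
def complConj (n k : ℕ) (lam : YoungDiagram) : YoungDiagram :=
  (boxComplement n k lam).transpose

/-- `‖μ‖ = ∑ (i - 1) μ_i`, the sum over `i = 1, …, m`. -/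
def rowNorm (m : ℕ) (mu : YoungDiagram) : ℕ :=
  ∑ i : Fin m, (i : ℕ) * mu.rowLen i

/-- The point `a_i = λ_i + n - i` (with `i` counted from `1`). -/
def point (n : ℕ) (lam : YoungDiagram) (i : Fin n) : ℕ :=
  lam.rowLen i + (n - 1 - (i : ℕ))

/-! ### Schur polynomials -/

/-- The semistandard Young tableaux of shape `mu` with entries in an alphabet of `m` letters
`0, …, m - 1`. -/
def SSYT (mu : YoungDiagram) (m : ℕ) : Type :=
  {T : SemistandardYoungTableau mu // ∀ c ∈ mu, T c.1 c.2 < m}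

instance (mu : YoungDiagram) (m : ℕ) : Finite (SSYT mu m) := by
  let f : SSYT mu m → (mu.cells → Fin m) := fun T c =>
    ⟨T.1 c.1.1 c.1.2, T.2 c.1 (YoungDiagram.mem_cells c.1 |>.1 c.2)⟩
  refine Finite.of_injective f ?_
  rintro ⟨T, hT⟩ ⟨S, hS⟩ h
  apply Subtype.ext
  apply SemistandardYoungTableau.ext
  intro i j
  by_cases hc : (i, j) ∈ mu
  · exact congrArg Fin.val (congrFun h ⟨(i, j), (YoungDiagram.mem_cells _).2 hc⟩)
  · change T i j = S i j
    rw [T.zeros hc, S.zeros hc]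

instance (mu : YoungDiagram) (m : ℕ) : Fintype (SSYT mu m) := Fintype.ofFinite _

/-- The number of cells of the tableau `T` with entry `i`. -/
def content {mu : YoungDiagram} {m : ℕ} (T : SSYT mu m) (i : Fin m) : ℕ :=
  (mu.cells.filter (fun c => T.1 c.1 c.2 = (i : ℕ))).card

/-- The Schur polynomial `s_μ(x_1, …, x_m)`, which is the character of the irreducible
representation of `GL_m` with highest weight `μ`. -/
def schurPoly (mu : YoungDiagram) (m : ℕ) : MvPolynomial (Fin m) ℤ :=
  ∑ T : SSYT mu m, ∏ i : Fin m, MvPolynomial.X i ^ content T i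

/-- The value of the Schur polynomial at a real point. -/
def schur (mu : YoungDiagram) {m : ℕ} (x : Fin m → ℝ) : ℝ :=
  MvPolynomial.aeval x (schurPoly mu m)

/-- The probability of `lam` for the character measure of skew Howe duality,
`s_λ(x) s_{λ̄'}(y) / ∏_{i,j} (x_i + y_j)`. -/
def characterMeasure {n k : ℕ} (x : Fin n → ℝ) (y : Fin k → ℝ) (lam : YoungDiagram) : ℝ :=
  schur lam x * schur (complConj n k lam) y / ∏ i : Fin n, ∏ j : Fin k, (x i + y j)

/-! ### The `q`-dimension -/

/-- The dimension of the weight subspace of weight `nu` in the irreducible representation of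
`GL_m` with highest weight `mu`, that is, the coefficient of `x ^ nu` in its character. -/
def weightMult (mu : YoungDiagram) {m : ℕ} (nu : Fin m → ℤ) : ℤ :=
  if ∀ i, 0 ≤ nu i then
    (schurPoly mu m).coeff (Finsupp.equivFunOnFinite.symm fun i => (nu i).toNat)
  else 0

/-- The simple root `α_i = e_i - e_{i+1}` of `GL_m`. -/
def simpleRoot (m : ℕ) (i : Fin (m - 1)) : Fin m → ℤ := fun j =>
  if (j : ℕ) = i then 1 else if (j : ℕ) = i + 1 then -1 else 0

/-- The `q`-dimension of the irreducible representation of `GL_m` with highest weight `mu`: the sum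
over `u = (u_1, …, u_{m-1})` of `q ^ (u_1 + ⋯ + u_{m-1})` times the dimension of the subspace of
weight `μ - ∑ u_i α_i`. Only finitely many terms are nonzero. -/
def qDim (m : ℕ) (mu : YoungDiagram) (q : ℝ) : ℝ :=
  ∑ᶠ u : Fin (m - 1) → ℕ, q ^ (∑ i, u i) *
    (weightMult mu (fun j : Fin m =>
      (mu.rowLen j : ℤ) - ∑ i, (u i : ℤ) * simpleRoot m i j) : ℝ)

/-- The measure `μ_{n,k}(λ | q)`. -/
def measureQ (n k : ℕ) (q : ℝ) (lam : YoungDiagram) : ℝ :=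
  (q ^ rowNorm n lam * qDim n lam q) *
    (q ^ rowNorm k (complConj n k lam) * qDim k (complConj n k lam) q) /
    ∏ i : Fin n, ∏ j : Fin k, (q ^ (i : ℕ) + q ^ (j : ℕ))

/-- The measure `μ_{n,k}(λ | q, q⁻¹)`. -/
def measureQInv (n k : ℕ) (q : ℝ) (lam : YoungDiagram) : ℝ :=
  (q ^ rowNorm n lam * qDim n lam q) *
    (q ^ (-(rowNorm k (complConj n k lam) : ℤ)) * qDim k (complConj n k lam) (1 / q)) /
    ∏ i : Fin n, ∏ j : Fin k, (q ^ (i : ℕ) + q ^ (-((j : ℕ) : ℤ)))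

/-! ### `q`-Krawtchouk polynomials -/

/-- The `q`-number `[m]_q`, for `q ≠ 1`. -/
def qNumber (q : ℝ) (m : ℕ) : ℝ := (1 - q ^ m) / (1 - q)

/-- The `q`-factorial `[m]_q!`. -/
def qFactorial (q : ℝ) (m : ℕ) : ℝ := ∏ i ∈ Finset.range m, qNumber q (i + 1)

/-- The `q`-binomial coefficient, for `a ≤ N`. -/
def qBinom (q : ℝ) (N a : ℕ) : ℝ := qFactorial q N / (qFactorial q a * qFactorial q (N - a))

/-- The `q`-Pochhammer symbol `(a; q)_m`. -/
def qPoch (a q : ℝ) (m : ℕ) : ℝ := ∏ i ∈ Finset.range m, (1 - a * q ^ i)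

/-- The `q`-Krawtchouk polynomial `K_j(z; p, N; q)` of degree `j ≤ N` in the variable `z`, the
terminating basic hypergeometric series `₃φ₂(q^{-j}, z, -p q^j; q^{-N}, 0; q, q)`. -/
def qKrawtchouk (j : ℕ) (z p : ℝ) (N : ℕ) (q : ℝ) : ℝ :=
  ∑ s ∈ Finset.range (j + 1),
    qPoch (q ^ (-(j : ℤ))) q s * qPoch z q s * qPoch (-p * q ^ j) q s /
      (qPoch (q ^ (-(N : ℤ))) q s * qPoch q q s) * q ^ s

/-- The orthogonality weight of the `q`-Krawtchouk polynomials at `z = q^{-x}`, `0 ≤ x ≤ N`. -/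
def qKrawtchoukWeight (p : ℝ) (N : ℕ) (q : ℝ) (x : ℕ) : ℝ :=
  qBinom q N x * p ^ (-(x : ℤ)) * q ^ ((x.choose 2 : ℤ) - (x : ℤ) * (N : ℤ))

/-- The normalized `q`-Krawtchouk polynomial at `q^{-x}`: `K_j(q^{-x}; p, N; q)` divided by its
norm in the space `ℓ²` of the weight. -/
def normQKrawtchouk (j : ℕ) (p : ℝ) (N : ℕ) (q : ℝ) (x : ℕ) : ℝ :=
  qKrawtchouk j (q ^ (-(x : ℤ))) p N q /
    Real.sqrt (∑ i ∈ Finset.range (N + 1),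
      qKrawtchoukWeight p N q i * qKrawtchouk j (q ^ (-(i : ℤ))) p N q ^ 2)

/-- The Christoffel–Darboux kernel of the first `n` normalized `q`-Krawtchouk polynomials, with the
weight function `W`. -/
def cdKernel (W : ℕ → ℝ) (p : ℝ) (N : ℕ) (q : ℝ) (n : ℕ) (a b : ℕ) : ℝ :=
  Real.sqrt (W a * W b) *
    ∑ l ∈ Finset.range n, normQKrawtchouk l p N q a * normQKrawtchouk l p N q b

/-- The weight `q^{C(a,2) + a(n-k)} [n+k-1 choose a]_q`. -/
def weightQ (n k : ℕ) (q : ℝ) (a : ℕ) : ℝ :=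
  q ^ ((a.choose 2 : ℤ) + (a : ℤ) * ((n : ℤ) - (k : ℤ))) * qBinom q (n + k - 1) a

/-- The weight `q^{C(a,2) + a(n-1)} [n+k-1 choose a]_q`. -/
def weightQInv (n k : ℕ) (q : ℝ) (a : ℕ) : ℝ :=
  q ^ ((a.choose 2 : ℤ) + (a : ℤ) * ((n : ℤ) - 1)) * qBinom q (n + k - 1) a

end

end SkewHowe

open SkewHowe

/-!
Both measures are computed in closed form and compared with the closed form of the determinant.

*The measures.* A semistandard tableau with `m + 1` letters is a tableau with `m` letters together
with a horizontal strip (`schur_branching`). Alternants `det (x_i ^ α_j)` obey the same recursion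
(`alternant_branching`), whence Cauchy's bialternant formula `vandermonde_mul_schur`. The
`q`-dimension is, up to a power of `q`, the value of the character at `x_i = q ^ i`
(`pow_rowNorm_mul_qDim`), since subtracting a simple root from a weight `ν` raises `∑ i ν_i` by one.
At such a geometric progression the alternant is itself a Vandermonde determinant, so that
`s_λ(1, q, …)` is the quotient of the Vandermonde products `vProd` over the points `q ^ a_i` and over
`1, q, …, q ^ (n - 1)` (`schur_geometric`). The points of the complement conjugate diagram are the
holes of the point configuration of `λ` (`pointSet_complConj`), and the Vandermonde product over the
holes is the one over the points divided by explicit one-point factors (`vProd_sdiff_mul`). The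
product of the two Schur polynomials therefore has the form
`const * ∏ w(a_i) * V(q ^ (-a_1), …, q ^ (-a_n)) ^ 2`, where `w` is a `q`-Krawtchouk weight
(`vProd_mul_vProd_sdiff`).

*The determinant.* The inner product of `K_j` with a monomial `z ^ m` is summed by the
`q`-binomial theorem and then by the `q`-Chu–Vandermonde formula (`sum_weight_qKrawtchouk`): it
vanishes for `m < j`, and for `m = j` it gives the norm `monicNormSq` of the monic polynomials. The
determinant of the kernel is `∏ w(a_i) * V ^ 2 / ∏ monicNormSq` (`det_cdKernel`). The product of the
norms telescopes (`prod_qPoch_div_qPoch`), and for the two values of `p` it yields exactly the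
normalizing products `∏ (x_i + y_j)` (`prod_monicNormSq_self`, `prod_monicNormSq_inv`).

*Total mass.* By the Cauchy–Binet formula `det_sum_mul`, the determinants of the kernel over all
`n`-point configurations sum to the Gram determinant of `n` orthonormal functions, which is `1`; the
diagrams in the box are in bijection with these configurations (`bijective_pointSet`).
-/


namespace SkewHowe

/-! ### The `q`-Pochhammer symbol and two `q`-summation formulas -/

section Pochhammer

variable {q : ℝ}

theorem choose_two_succ (s : ℕ) : ((s + 1).choose 2 : ℤ) = s.choose 2 + s := by
  rw [Nat.choose_succ_succ' s 1, Nat.choose_one_right]; push_cast; ring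

theorem choose_two_mul_two (s : ℕ) : 2 * (s.choose 2 : ℤ) = s * (s - 1) := by
  induction s with
  | zero => simp
  | succ s ih => rw [choose_two_succ]; push_cast; linarith

theorem choose_two_add (s t : ℕ) :
    ((s + t).choose 2 : ℤ) = s.choose 2 + t.choose 2 + s * t := by
  have h1 := choose_two_mul_two s
  have h2 := choose_two_mul_two t
  have h3 := choose_two_mul_two (s + t)
  push_cast at h3
  linarith

theorem qPoch_zero (a q : ℝ) : qPoch a q 0 = 1 := by simp [qPoch]

theorem qPoch_succ (a q : ℝ) (m : ℕ) : qPoch a q (m + 1) = qPoch a q m * (1 - a * q ^ m) := by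
  simp [qPoch, Finset.prod_range_succ]

theorem qPoch_succ_left (a q : ℝ) (m : ℕ) :
    qPoch a q (m + 1) = (1 - a) * qPoch (a * q) q m := by
  simp only [qPoch, Finset.prod_range_succ']
  rw [mul_comm]
  congr 1
  · simp
  · exact Finset.prod_congr rfl fun i _ => by ring

theorem qPoch_add (a q : ℝ) (m l : ℕ) :
    qPoch a q (m + l) = qPoch a q m * qPoch (a * q ^ m) q l := by
  simp only [qPoch, Finset.prod_range_add]
  congr 1
  exact Finset.prod_congr rfl fun i _ => by ring

theorem one_sub_pow_ne_zero (hq0 : 0 < q) (hq1 : q ≠ 1) {m : ℕ} (hm : m ≠ 0) :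
    1 - q ^ m ≠ 0 := by
  rw [sub_ne_zero, ne_comm]
  intro h
  exact hq1 ((pow_eq_one_iff_of_nonneg hq0.le hm).1 h)

theorem qPoch_self_ne_zero (hq0 : 0 < q) (hq1 : q ≠ 1) (m : ℕ) : qPoch q q m ≠ 0 := by
  rw [qPoch, Finset.prod_ne_zero_iff]
  intro i _
  rw [← pow_succ']
  exact one_sub_pow_ne_zero hq0 hq1 i.succ_ne_zero

theorem qPoch_pos_of_neg (hq0 : 0 < q) {b : ℝ} (hb : 0 < b) (m : ℕ) : 0 < qPoch (-b) q m := by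
  rw [qPoch]
  refine Finset.prod_pos fun i _ => ?_
  have := mul_pos hb (pow_pos hq0 i)
  linarith

theorem qPoch_self_succ (q : ℝ) (m : ℕ) :
    qPoch q q (m + 1) = qPoch q q m * (1 - q ^ (m + 1)) := by
  rw [qPoch_succ, pow_succ']

/-- The numerator factors `(q^{-x}; q)_s`, with `x = s + y`. -/
theorem qPoch_zpow_neg (hq0 : 0 < q) (s y : ℕ) :
    qPoch (q ^ (-((s + y : ℕ) : ℤ))) q s * qPoch q q y =
      (-1) ^ s * q ^ ((s.choose 2 : ℤ) - (s + y) * s) * qPoch q q (s + y) := by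
  induction s with
  | zero => simp [qPoch_zero]
  | succ s ih =>
    have hq : q ≠ 0 := hq0.ne'
    have e1 : q ^ (-((s + 1 + y : ℕ) : ℤ)) * q = q ^ (-((s + y : ℕ) : ℤ)) := by
      rw [← zpow_add_one₀ hq]; congr 1; push_cast; ring
    have e2 : (1 : ℝ) - q ^ (-((s + 1 + y : ℕ) : ℤ)) =
        -q ^ (-((s + 1 + y : ℕ) : ℤ)) * (1 - q ^ (s + y + 1)) := by
      have : q ^ (-((s + 1 + y : ℕ) : ℤ)) * q ^ (s + y + 1) = 1 := by
        rw [← zpow_natCast q, ← zpow_add₀ hq, ← zpow_zero q]; congr 1; push_cast; ring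
      linear_combination -this
    have e3 : q ^ (((s + 1).choose 2 : ℤ) - ((s + 1 : ℕ) + y) * (s + 1 : ℕ)) =
        q ^ (-((s + 1 + y : ℕ) : ℤ)) * q ^ ((s.choose 2 : ℤ) - (s + y) * s) := by
      rw [← zpow_add₀ hq]; congr 1; rw [choose_two_succ]; push_cast; ring
    rw [qPoch_succ_left, e1, mul_assoc, ih, e2, e3, show s + 1 + y = s + y + 1 by ring,
      qPoch_self_succ]
    ring

/-- The `q`-binomial theorem, with the `q`-binomial coefficient written as a quotient of
Pochhammer symbols. -/
theorem qBinomial_theorem (hq0 : 0 < q) (hq1 : q ≠ 1) (N : ℕ) (t : ℝ) :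
    ∑ c ∈ Finset.HasAntidiagonal.antidiagonal N,
        q ^ c.1.choose 2 * t ^ c.1 / (qPoch q q c.1 * qPoch q q c.2) =
      qPoch (-t) q N / qPoch q q N := by
  induction N generalizing t with
  | zero => simp [qPoch_zero]
  | succ N ih =>
    have hN := one_sub_pow_ne_zero hq0 hq1 N.succ_ne_zero
    have hP := qPoch_self_ne_zero hq0 hq1
    rw [eq_div_iff (hP _), qPoch_self_succ]
    -- Split `1 - q ^ (x + y)` as `(1 - q ^ x) + q ^ x * (1 - q ^ y)`.
    have key : (∑ c ∈ Finset.HasAntidiagonal.antidiagonal (N + 1),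
          q ^ c.1.choose 2 * t ^ c.1 / (qPoch q q c.1 * qPoch q q c.2)) * (1 - q ^ (N + 1)) =
        (∑ c ∈ Finset.HasAntidiagonal.antidiagonal (N + 1),
          q ^ c.1.choose 2 * t ^ c.1 / (qPoch q q c.1 * qPoch q q c.2) * (1 - q ^ c.1)) +
        ∑ c ∈ Finset.HasAntidiagonal.antidiagonal (N + 1),
          q ^ c.1.choose 2 * t ^ c.1 / (qPoch q q c.1 * qPoch q q c.2) *
            (q ^ c.1 * (1 - q ^ c.2)) := by
      rw [Finset.sum_mul, ← Finset.sum_add_distrib]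
      refine Finset.sum_congr rfl fun c hc => ?_
      rw [← Finset.HasAntidiagonal.mem_antidiagonal.1 hc]
      ring
    have t1 : (∑ c ∈ Finset.HasAntidiagonal.antidiagonal (N + 1),
          q ^ c.1.choose 2 * t ^ c.1 / (qPoch q q c.1 * qPoch q q c.2) * (1 - q ^ c.1)) =
        t * (qPoch (-(t * q)) q N / qPoch q q N) := by
      rw [Finset.Nat.sum_antidiagonal_succ, ← ih (t * q), Finset.mul_sum]
      simp only [pow_zero, sub_self, mul_zero, zero_add]
      refine Finset.sum_congr rfl fun c _ => ?_
      have h1 := one_sub_pow_ne_zero hq0 hq1 c.1.succ_ne_zero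
      rw [qPoch_self_succ, Nat.choose_succ_succ' c.1 1, Nat.choose_one_right]
      field_simp [hP c.1, hP c.2]
      ring
    have t2 : (∑ c ∈ Finset.HasAntidiagonal.antidiagonal (N + 1),
          q ^ c.1.choose 2 * t ^ c.1 / (qPoch q q c.1 * qPoch q q c.2) *
            (q ^ c.1 * (1 - q ^ c.2))) = qPoch (-(t * q)) q N / qPoch q q N := by
      rw [Finset.Nat.sum_antidiagonal_succ', ← ih (t * q)]
      simp only [pow_zero, sub_self, mul_zero, zero_add]
      refine Finset.sum_congr rfl fun c _ => ?_
      have h1 := one_sub_pow_ne_zero hq0 hq1 c.2.succ_ne_zero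
      rw [qPoch_self_succ]
      field_simp [hP c.1, hP c.2]
      rw [mul_pow]
    rw [mul_comm (qPoch q q N), ← mul_assoc, key, t1, t2, qPoch_succ_left]
    field_simp [hP N]
    ring_nf

/-- The `q`-Chu–Vandermonde summation, cleared of negative powers of `q`. -/
theorem qChuVandermonde (hq0 : 0 < q) (hq1 : q ≠ 1) (j : ℕ) (b c : ℝ) :
    ∑ d ∈ Finset.HasAntidiagonal.antidiagonal j, (-1) ^ d.1 * q ^ d.2.choose 2 *
        (qPoch b q d.1 * qPoch (c * q ^ d.1) q d.2) / (qPoch q q d.1 * qPoch q q d.2) =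
      q ^ j.choose 2 * (∏ i ∈ Finset.range j, (b - c * q ^ i)) / qPoch q q j := by
  induction j generalizing b c with
  | zero => simp [qPoch_zero]
  | succ j ih =>
    have hP := qPoch_self_ne_zero hq0 hq1
    have hN := one_sub_pow_ne_zero hq0 hq1 j.succ_ne_zero
    set F : ℕ × ℕ → ℝ := fun d => (-1) ^ d.1 * q ^ d.2.choose 2 *
        (qPoch b q d.1 * qPoch (c * q ^ d.1) q d.2) / (qPoch q q d.1 * qPoch q q d.2) with hF
    -- Here the splitting is `(1 - q ^ s) + q ^ s * (1 - q ^ t)`, with `s + t = j + 1`.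
    have key : (∑ d ∈ Finset.HasAntidiagonal.antidiagonal (j + 1), F d) * (1 - q ^ (j + 1)) =
        (∑ d ∈ Finset.HasAntidiagonal.antidiagonal (j + 1), F d * (1 - q ^ d.1)) +
        ∑ d ∈ Finset.HasAntidiagonal.antidiagonal (j + 1), F d * (q ^ d.1 * (1 - q ^ d.2)) := by
      rw [Finset.sum_mul, ← Finset.sum_add_distrib]
      refine Finset.sum_congr rfl fun c hc => ?_
      rw [← Finset.HasAntidiagonal.mem_antidiagonal.1 hc]
      ring
    have t1 : (∑ d ∈ Finset.HasAntidiagonal.antidiagonal (j + 1), F d * (1 - q ^ d.1)) =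
        -(1 - b) * (q ^ j.choose 2 * (∏ i ∈ Finset.range j, (b * q - c * q * q ^ i)) /
          qPoch q q j) := by
      rw [Finset.Nat.sum_antidiagonal_succ, ← ih (b * q) (c * q), Finset.mul_sum]
      simp only [pow_zero, sub_self, mul_zero, zero_add]
      refine Finset.sum_congr rfl fun d _ => ?_
      have h1 := one_sub_pow_ne_zero hq0 hq1 d.1.succ_ne_zero
      simp only [hF]
      rw [qPoch_self_succ, qPoch_succ_left, show c * q ^ (d.1 + 1) = c * q * q ^ d.1 by ring]
      field_simp [hP d.1, hP d.2]
      ring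
    have t2 : (∑ d ∈ Finset.HasAntidiagonal.antidiagonal (j + 1), F d * (q ^ d.1 * (1 - q ^ d.2))) =
        q ^ j * (1 - c * q ^ j) * (q ^ j.choose 2 * (∏ i ∈ Finset.range j, (b - c * q ^ i)) /
          qPoch q q j) := by
      rw [Finset.Nat.sum_antidiagonal_succ', ← ih b c, Finset.mul_sum]
      simp only [pow_zero, sub_self, mul_zero, zero_add]
      refine Finset.sum_congr rfl fun d hd => ?_
      have h1 := one_sub_pow_ne_zero hq0 hq1 d.2.succ_ne_zero
      simp only [hF]
      rw [← Finset.HasAntidiagonal.mem_antidiagonal.1 hd, qPoch_self_succ, qPoch_succ,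
        Nat.choose_succ_succ' d.2 1, Nat.choose_one_right]
      field_simp [hP d.1, hP d.2]
      ring
    have t3 : ∏ i ∈ Finset.range j, (b * q - c * q * q ^ i) =
        q ^ j * ∏ i ∈ Finset.range j, (b - c * q ^ i) := by
      rw [show q ^ j = ∏ _i ∈ Finset.range j, q by simp, ← Finset.prod_mul_distrib]
      exact Finset.prod_congr rfl fun i _ => by ring
    rw [eq_div_iff (hP _), qPoch_self_succ, mul_comm (qPoch q q j), ← mul_assoc, key, t1, t2, t3,
      Finset.prod_range_succ, Nat.choose_succ_succ' j 1, Nat.choose_one_right]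
    field_simp [hP j]
    ring

end Pochhammer

/-! ### Moments of the `q`-Krawtchouk weight -/

section Krawtchouk

variable {q p : ℝ}

theorem qNumber_pos (hq0 : 0 < q) (hq1 : q ≠ 1) (m : ℕ) : 0 < qNumber q (m + 1) := by
  rw [qNumber]
  rcases lt_or_gt_of_ne hq1 with h | h
  · exact div_pos (sub_pos.2 (pow_lt_one₀ hq0.le h m.succ_ne_zero)) (sub_pos.2 h)
  · exact div_pos_of_neg_of_neg (sub_neg.2 (one_lt_pow₀ h m.succ_ne_zero)) (sub_neg.2 h)

theorem qFactorial_pos (hq0 : 0 < q) (hq1 : q ≠ 1) (m : ℕ) : 0 < qFactorial q m :=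
  Finset.prod_pos fun i _ => qNumber_pos hq0 hq1 i

theorem qFactorial_mul_pow (hq1 : q ≠ 1) (m : ℕ) :
    qFactorial q m * (1 - q) ^ m = qPoch q q m := by
  have h : 1 - q ≠ 0 := sub_ne_zero.2 hq1.symm
  induction m with
  | zero => simp [qFactorial, qPoch]
  | succ m ih =>
    rw [qFactorial, Finset.prod_range_succ, ← qFactorial, qPoch_self_succ, ← ih, qNumber]
    field_simp
    ring

theorem qBinom_pos (hq0 : 0 < q) (hq1 : q ≠ 1) (N a : ℕ) : 0 < qBinom q N a :=
  div_pos (qFactorial_pos hq0 hq1 _)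
    (mul_pos (qFactorial_pos hq0 hq1 _) (qFactorial_pos hq0 hq1 _))

theorem qBinom_add (hq1 : q ≠ 1) (x y : ℕ) :
    qBinom q (x + y) x = qPoch q q (x + y) / (qPoch q q x * qPoch q q y) := by
  have h : 1 - q ≠ 0 := sub_ne_zero.2 hq1.symm
  rw [qBinom, Nat.add_sub_cancel_left, ← qFactorial_mul_pow hq1, ← qFactorial_mul_pow hq1,
    ← qFactorial_mul_pow hq1, pow_add]
  field_simp

theorem qKrawtchoukWeight_pos (hq0 : 0 < q) (hq1 : q ≠ 1) (hp : 0 < p) (N x : ℕ) :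
    0 < qKrawtchoukWeight p N q x :=
  mul_pos (mul_pos (qBinom_pos hq0 hq1 _ _) (zpow_pos hp _)) (zpow_pos hq0 _)

theorem qPoch_zpow_neg_eq_zero (hq0 : 0 < q) {x s : ℕ} (h : x < s) :
    qPoch (q ^ (-(x : ℤ))) q s = 0 := by
  rw [qPoch, Finset.prod_eq_zero_iff]
  refine ⟨x, Finset.mem_range.2 h, ?_⟩
  rw [← zpow_natCast q x, ← zpow_add₀ hq0.ne', neg_add_cancel, zpow_zero, sub_self]

theorem qPoch_zpow_neg_ne_zero (hq0 : 0 < q) (hq1 : q ≠ 1) {x s : ℕ} (h : s ≤ x) :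
    qPoch (q ^ (-(x : ℤ))) q s ≠ 0 := by
  obtain ⟨y, rfl⟩ := Nat.exists_eq_add_of_le h
  have h1 := qPoch_zpow_neg hq0 s y
  intro h0
  rw [h0, zero_mul, eq_comm] at h1
  refine absurd h1 (mul_ne_zero (mul_ne_zero (by simp) (zpow_ne_zero _ hq0.ne'))
    (qPoch_self_ne_zero hq0 hq1 _))

theorem qPoch_reverse (hq0 : 0 < q) {u : ℝ} (hu : u ≠ 0) (r : ℕ) :
    qPoch (-(u⁻¹ * q ^ (-(r : ℤ)))) q r =
      u⁻¹ ^ r * q ^ (-((r + 1).choose 2 : ℤ)) * qPoch (-(u * q)) q r := by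
  have hq : q ≠ 0 := hq0.ne'
  induction r with
  | zero => simp [qPoch_zero]
  | succ r ih =>
    have e1 : -(u⁻¹ * q ^ (-((r + 1 : ℕ) : ℤ))) * q = -(u⁻¹ * q ^ (-(r : ℤ))) := by
      rw [neg_mul, mul_assoc, ← zpow_add_one₀ hq]; congr 3; push_cast; ring
    have e2 : 1 - -(u⁻¹ * q ^ (-((r + 1 : ℕ) : ℤ))) =
        u⁻¹ * q ^ (-((r + 1 : ℕ) : ℤ)) * (1 - -(u * q) * q ^ r) := by
      have : q ^ (-((r + 1 : ℕ) : ℤ)) * (q * q ^ r) = 1 := by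
        rw [← pow_succ', ← zpow_natCast q, ← zpow_add₀ hq, ← zpow_zero q]
        congr 1; push_cast; ring
      have hu' := inv_mul_cancel₀ hu
      linear_combination -(u⁻¹ * u) * this - hu'
    have e3 : q ^ (-((r + 1 + 1).choose 2 : ℤ)) =
        q ^ (-((r + 1).choose 2 : ℤ)) * q ^ (-((r + 1 : ℕ) : ℤ)) := by
      rw [← zpow_add₀ hq]; congr 1; rw [choose_two_succ (r + 1)]; ring
    rw [qPoch_succ_left, e1, ih, qPoch_succ, e2, e3]
    ring

/-- The sum of the weight against `(z; q)_s z ^ m`, `z = q ^ (-x)`: shifting `x` by `s` turns it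
into the `q`-binomial theorem. -/
theorem sum_weight_qPoch (hq0 : 0 < q) (hq1 : q ≠ 1) (hp : 0 < p) (s r m : ℕ) :
    ∑ x ∈ Finset.range (s + r + 1), qKrawtchoukWeight p (s + r) q x *
        qPoch (q ^ (-(x : ℤ))) q s * (q ^ (-(x : ℤ))) ^ m =
      qPoch (q ^ (-((s + r : ℕ) : ℤ))) q s * (p ^ (-((s + r : ℕ) : ℤ)) *
        q ^ (-(m * (s + r) : ℤ) - ((s + r + 1).choose 2 : ℤ)) *
        qPoch (-(p * q ^ (m + 1 + s))) q r) := by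
  have hq : q ≠ 0 := hq0.ne'
  have hP := qPoch_self_ne_zero hq0 hq1
  set A : ℝ := p⁻¹ * q ^ (-((s + r + m : ℕ) : ℤ)) with hA
  have hterm : ∀ c ∈ Finset.HasAntidiagonal.antidiagonal r,
      qKrawtchoukWeight p (s + r) q (s + c.1) *
        qPoch (q ^ (-((s + c.1 : ℕ) : ℤ))) q s * (q ^ (-((s + c.1 : ℕ) : ℤ))) ^ m =
      (qPoch q q (s + r) * (-1) ^ s * p ^ (-(s : ℤ)) * q ^ (-(s : ℤ) - s * (s + r + m))) *
        (q ^ c.1.choose 2 * A ^ c.1 / (qPoch q q c.1 * qPoch q q c.2)) := by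
    rintro ⟨y, z⟩ hc
    have hr : y + z = r := Finset.HasAntidiagonal.mem_antidiagonal.1 hc
    have h1 := qPoch_zpow_neg hq0 s y
    rw [← eq_div_iff (hP y)] at h1
    have h2 : qBinom q (s + r) (s + y) =
        qPoch q q (s + r) / (qPoch q q (s + y) * qPoch q q z) := by
      rw [← hr, ← add_assoc, qBinom_add hq1]
    have h3 : p ^ (-((s + y : ℕ) : ℤ)) = p ^ (-(s : ℤ)) * p⁻¹ ^ y := by
      rw [← zpow_natCast p⁻¹, inv_zpow', ← zpow_add₀ hp.ne']; congr 1; push_cast; ring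
    have h4 : q ^ (((s + y).choose 2 : ℤ) - ((s + y : ℕ) : ℤ) * ((s + r : ℕ) : ℤ)) *
          q ^ ((s.choose 2 : ℤ) - (s + y) * s) * (q ^ (-((s + y : ℕ) : ℤ))) ^ m =
        q ^ (-(s : ℤ) - s * (s + r + m)) *
          (q ^ y.choose 2 * (q ^ (-((s + r + m : ℕ) : ℤ))) ^ y) := by
      simp only [← zpow_natCast, ← zpow_mul, ← zpow_add₀ hq]
      congr 1
      have := choose_two_mul_two s
      rw [choose_two_add]
      push_cast
      linear_combination this
    rw [qKrawtchoukWeight, h1, h2, h3, hA, mul_pow]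
    field_simp [hP y, hP z, hP (s + y)]
    linear_combination qPoch q q (s + r) * h4
  have h0 : ∑ x ∈ Finset.range s, qKrawtchoukWeight p (s + r) q x *
        qPoch (q ^ (-(x : ℤ))) q s * (q ^ (-(x : ℤ))) ^ m = 0 :=
    Finset.sum_eq_zero fun x hx => by
      rw [qPoch_zpow_neg_eq_zero hq0 (Finset.mem_range.1 hx), mul_zero, zero_mul]
  rw [add_assoc, Finset.sum_range_add, h0, zero_add,
    ← Finset.Nat.sum_antidiagonal_eq_sum_range_succ
      (fun y _ => qKrawtchoukWeight p (s + r) q (s + y) *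
        qPoch (q ^ (-((s + y : ℕ) : ℤ))) q s * (q ^ (-((s + y : ℕ) : ℤ))) ^ m) r,
    Finset.sum_congr rfl hterm, ← Finset.mul_sum, qBinomial_theorem hq0 hq1]
  have h5 : A = (p * q ^ (m + s))⁻¹ * q ^ (-(r : ℤ)) := by
    rw [hA, mul_inv, ← zpow_natCast q, ← zpow_neg, mul_assoc, ← zpow_add₀ hq]
    congr 2; push_cast; ring
  have h6 := qPoch_zpow_neg hq0 s r
  rw [← eq_div_iff (hP r)] at h6
  have h7 : p * q ^ (m + 1 + s) = p * q ^ (m + s) * q := by ring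
  have h8 : (p * q ^ (m + s))⁻¹ ^ r = p ^ (-(r : ℤ)) * q ^ (-((m + s) * r : ℤ)) := by
    rw [inv_pow, mul_pow, mul_inv, ← pow_mul, ← zpow_natCast q, ← zpow_natCast p, ← zpow_neg,
      ← zpow_neg]
    push_cast; rfl
  have h9 : p ^ (-((s + r : ℕ) : ℤ)) = p ^ (-(s : ℤ)) * p ^ (-(r : ℤ)) := by
    rw [← zpow_add₀ hp.ne']; congr 1; push_cast; ring
  have h10 : q ^ (-(s : ℤ) - s * (s + r + m)) * q ^ (-((m + s) * r : ℤ)) *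
        q ^ (-((r + 1).choose 2 : ℤ)) =
      q ^ ((s.choose 2 : ℤ) - (s + r) * s) *
        q ^ (-(m * (s + r) : ℤ) - ((s + r + 1).choose 2 : ℤ)) := by
    simp only [← zpow_add₀ hq]
    congr 1
    rw [choose_two_succ (s + r), choose_two_add s r, choose_two_succ r]
    push_cast
    ring
  rw [h5, qPoch_reverse hq0 (mul_ne_zero hp.ne' (pow_ne_zero _ hq)), h6, h7, h8, h9]
  field_simp [hP r]
  linear_combination qPoch q q (s + r) * qPoch (-(p * q ^ (m + s) * q)) q r * h10

/-- The inner products of the `q`-Krawtchouk polynomials with the monomials `z ^ m`; the last product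
vanishes for `m < j`. -/
theorem sum_weight_qKrawtchouk (hq0 : 0 < q) (hq1 : q ≠ 1) (hp : 0 < p) {j N : ℕ} (hj : j ≤ N)
    (m : ℕ) :
    ∑ x ∈ Finset.range (N + 1), qKrawtchoukWeight p N q x *
        qKrawtchouk j (q ^ (-(x : ℤ))) p N q * (q ^ (-(x : ℤ))) ^ m =
      p ^ (-(N : ℤ)) * q ^ (-(m * N : ℤ) - ((N + 1).choose 2 : ℤ)) *
        qPoch (-(p * q ^ (m + 1 + j))) q (N - j) *
        ∏ i ∈ Finset.range j, (-p * q ^ j - -(p * q ^ (m + 1)) * q ^ i) := by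
  have hq : q ≠ 0 := hq0.ne'
  have hP := qPoch_self_ne_zero hq0 hq1
  have h1 : ∀ s ∈ Finset.range (j + 1), ∑ x ∈ Finset.range (N + 1), qKrawtchoukWeight p N q x *
        qPoch (q ^ (-(x : ℤ))) q s * (q ^ (-(x : ℤ))) ^ m =
      qPoch (q ^ (-(N : ℤ))) q s * (p ^ (-(N : ℤ)) *
        q ^ (-(m * N : ℤ) - ((N + 1).choose 2 : ℤ)) *
        (qPoch (-(p * q ^ (m + 1 + s))) q (j - s) *
          qPoch (-(p * q ^ (m + 1 + j))) q (N - j))) := by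
    intro s hs
    have hs' : s ≤ j := Nat.lt_succ_iff.1 (Finset.mem_range.1 hs)
    obtain ⟨r, rfl⟩ := Nat.exists_eq_add_of_le (hs'.trans hj)
    rw [sum_weight_qPoch hq0 hq1 hp, show r = (j - s) + (s + r - j) by omega, qPoch_add,
      ← show r = (j - s) + (s + r - j) by omega]
    have : -(p * q ^ (m + 1 + s)) * q ^ (j - s) = -(p * q ^ (m + 1 + j)) := by
      rw [neg_mul, mul_assoc, ← pow_add, show m + 1 + s + (j - s) = m + 1 + j by omega]
    rw [this]
    push_cast
    ring
  have h2 : ∀ s ∈ Finset.range (j + 1),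
      qPoch (q ^ (-(j : ℤ))) q s * qPoch (-p * q ^ j) q s / qPoch q q s * q ^ s *
        qPoch (-(p * q ^ (m + 1 + s))) q (j - s) =
      q ^ (-(j.choose 2 : ℤ)) * qPoch q q j * ((-1) ^ s * q ^ (j - s).choose 2 *
        (qPoch (-p * q ^ j) q s * qPoch (-(p * q ^ (m + 1)) * q ^ s) q (j - s)) /
          (qPoch q q s * qPoch q q (j - s))) := by
    intro s hs
    obtain ⟨t, rfl⟩ := Nat.exists_eq_add_of_le (Nat.lt_succ_iff.1 (Finset.mem_range.1 hs))
    have h3 := qPoch_zpow_neg hq0 s t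
    rw [← eq_div_iff (hP t)] at h3
    rw [h3, Nat.add_sub_cancel_left]
    have h4 : q ^ ((s.choose 2 : ℤ) - (s + t) * s) * q ^ s =
        q ^ (-((s + t).choose 2 : ℤ)) * q ^ t.choose 2 := by
      simp only [← zpow_natCast, ← zpow_add₀ hq]
      congr 1
      have := choose_two_mul_two s
      rw [choose_two_add]
      linear_combination this
    have h5 : -(p * q ^ (m + 1 + s)) = -(p * q ^ (m + 1)) * q ^ s := by ring
    rw [h5]
    field_simp [hP s, hP t]
    linear_combination qPoch q q (s + t) * qPoch (-(p * q ^ (s + t))) q s *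
      qPoch (-(p * q ^ s * q ^ (m + 1))) q t * h4
  have h6 : ∑ s ∈ Finset.range (j + 1), (-1) ^ s * q ^ (j - s).choose 2 *
        (qPoch (-p * q ^ j) q s * qPoch (-(p * q ^ (m + 1)) * q ^ s) q (j - s)) /
          (qPoch q q s * qPoch q q (j - s)) =
      q ^ j.choose 2 * (∏ i ∈ Finset.range j, (-p * q ^ j - -(p * q ^ (m + 1)) * q ^ i)) /
        qPoch q q j := by
    rw [← qChuVandermonde hq0 hq1, ← Finset.Nat.sum_antidiagonal_eq_sum_range_succ
      (fun s t => (-1) ^ s * q ^ t.choose 2 *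
        (qPoch (-p * q ^ j) q s * qPoch (-(p * q ^ (m + 1)) * q ^ s) q t) /
          (qPoch q q s * qPoch q q t))]
  calc _ = ∑ x ∈ Finset.range (N + 1), ∑ s ∈ Finset.range (j + 1),
        (qPoch (q ^ (-(j : ℤ))) q s * qPoch (-p * q ^ j) q s /
          (qPoch (q ^ (-(N : ℤ))) q s * qPoch q q s) * q ^ s) *
        (qKrawtchoukWeight p N q x * qPoch (q ^ (-(x : ℤ))) q s * (q ^ (-(x : ℤ))) ^ m) := by
        refine Finset.sum_congr rfl fun x _ => ?_
        rw [qKrawtchouk, Finset.mul_sum, Finset.sum_mul]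
        exact Finset.sum_congr rfl fun s _ => by ring
    _ = ∑ s ∈ Finset.range (j + 1), p ^ (-(N : ℤ)) *
          q ^ (-(m * N : ℤ) - ((N + 1).choose 2 : ℤ)) *
          qPoch (-(p * q ^ (m + 1 + j))) q (N - j) *
          (qPoch (q ^ (-(j : ℤ))) q s * qPoch (-p * q ^ j) q s / qPoch q q s * q ^ s *
            qPoch (-(p * q ^ (m + 1 + s))) q (j - s)) := by
        rw [Finset.sum_comm]
        refine Finset.sum_congr rfl fun s hs => ?_
        rw [← Finset.mul_sum, h1 s hs]
        have hs' : s ≤ j := Nat.lt_succ_iff.1 (Finset.mem_range.1 hs)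
        have := qPoch_zpow_neg_ne_zero hq0 hq1 (hs'.trans hj)
        field_simp [hP s]
    _ = _ := by
        rw [← Finset.mul_sum, Finset.sum_congr rfl h2, ← Finset.mul_sum, h6]
        have : q ^ (-(j.choose 2 : ℤ)) * q ^ j.choose 2 = 1 := by
          rw [← zpow_natCast q, ← zpow_add₀ hq, neg_add_cancel, zpow_zero]
        have h7 := hP j
        generalize ∏ i ∈ Finset.range j, (-p * q ^ j - -(p * q ^ (m + 1)) * q ^ i) = Z
        generalize qPoch (-(p * q ^ (m + 1 + j))) q (N - j) = Y
        generalize p ^ (-(N : ℤ)) * q ^ (-(m * N : ℤ) - ((N + 1).choose 2 : ℤ)) = X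
        rw [show X * Y * (q ^ (-(j.choose 2 : ℤ)) * qPoch q q j *
          (q ^ j.choose 2 * Z / qPoch q q j)) = X * Y * Z *
            (q ^ (-(j.choose 2 : ℤ)) * q ^ j.choose 2) * (qPoch q q j / qPoch q q j) by ring,
          this, div_self h7, mul_one, mul_one]

end Krawtchouk

/-! ### Orthogonality and norms of the `q`-Krawtchouk polynomials -/

section Orthogonality

open Polynomial

variable {q p : ℝ}

/-- `K_j(z; p, N; q)` as a polynomial in `z`. -/
noncomputable def krawtchoukPoly (p : ℝ) (N : ℕ) (q : ℝ) (j : ℕ) : ℝ[X] :=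
  ∑ s ∈ Finset.range (j + 1),
    C (qPoch (q ^ (-(j : ℤ))) q s * qPoch (-p * q ^ j) q s /
      (qPoch (q ^ (-(N : ℤ))) q s * qPoch q q s) * q ^ s) *
      ∏ i ∈ Finset.range s, (1 - X * C (q ^ i))

theorem eval_krawtchoukPoly (p : ℝ) (N : ℕ) (q : ℝ) (j : ℕ) (z : ℝ) :
    (krawtchoukPoly p N q j).eval z = qKrawtchouk j z p N q := by
  simp only [krawtchoukPoly, qKrawtchouk, eval_finsetSum, eval_mul, eval_C, eval_prod, eval_sub,
    eval_one, eval_X, qPoch]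
  exact Finset.sum_congr rfl fun s _ => by ring

theorem natDegree_one_sub_X_mul_C_le (c : ℝ) : (1 - X * C c).natDegree ≤ 1 := by
  refine (natDegree_sub_le _ _).trans ?_
  rw [natDegree_one, zero_max]
  exact natDegree_mul_le.trans (by simp)

theorem natDegree_prod_one_sub_X_mul_C_le (q : ℝ) (s : ℕ) :
    (∏ i ∈ Finset.range s, (1 - X * C (q ^ i))).natDegree ≤ s := by
  refine (natDegree_prod_le _ _).trans ((Finset.sum_le_card_nsmul _ _ 1 fun i _ =>
    natDegree_one_sub_X_mul_C_le _).trans ?_)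
  simp

theorem coeff_prod_one_sub_X_mul_C (q : ℝ) (s : ℕ) :
    (∏ i ∈ Finset.range s, (1 - X * C (q ^ i))).coeff s = (-1) ^ s * q ^ s.choose 2 := by
  have h := coeff_prod_of_natDegree_le (Finset.range s) (fun i => 1 - X * C (q ^ i)) 1
    fun i _ => natDegree_one_sub_X_mul_C_le _
  rw [Finset.card_range, mul_one] at h
  rw [h]
  induction s with
  | zero => simp
  | succ s ih =>
    have h' := coeff_prod_of_natDegree_le (Finset.range s) (fun i => 1 - X * C (q ^ i)) 1
      fun i _ => natDegree_one_sub_X_mul_C_le _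
    rw [Finset.card_range, mul_one] at h'
    rw [Finset.prod_range_succ, ih h', Nat.choose_succ_succ' s 1, Nat.choose_one_right]
    simp only [coeff_sub, coeff_one, one_ne_zero, if_false, coeff_mul_C, coeff_X_one]
    ring

theorem natDegree_krawtchoukPoly_le (p : ℝ) (N : ℕ) (q : ℝ) (j : ℕ) :
    (krawtchoukPoly p N q j).natDegree ≤ j := by
  refine natDegree_sum_le_of_forall_le _ _ fun s hs => (natDegree_C_mul_le _ _).trans ?_
  exact (natDegree_prod_one_sub_X_mul_C_le q s).trans (Nat.lt_succ_iff.1 (Finset.mem_range.1 hs))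

/-- The leading coefficient of `K_j(z; p, N; q)`. -/
noncomputable def krawtchoukLead (p : ℝ) (N : ℕ) (q : ℝ) (j : ℕ) : ℝ :=
  qPoch (-p * q ^ j) q j / qPoch (q ^ (-(N : ℤ))) q j

theorem coeff_krawtchoukPoly (hq0 : 0 < q) (hq1 : q ≠ 1) (p : ℝ) (N j : ℕ) :
    (krawtchoukPoly p N q j).coeff j = krawtchoukLead p N q j := by
  rw [krawtchoukPoly, finsetSum_coeff, Finset.sum_range_succ, Finset.sum_eq_zero, zero_add,
    coeff_C_mul, coeff_prod_one_sub_X_mul_C, krawtchoukLead]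
  · have hP := qPoch_self_ne_zero hq0 hq1 j
    have h := qPoch_zpow_neg hq0 j 0
    rw [qPoch_zero, mul_one, add_zero] at h
    rw [h]
    have h2 : q ^ ((j.choose 2 : ℤ) - ((j : ℤ) + (0 : ℕ)) * j) * q ^ j * q ^ j.choose 2 = 1 := by
      rw [← zpow_natCast q, ← zpow_natCast q, ← zpow_add₀ hq0.ne', ← zpow_add₀ hq0.ne',
        ← zpow_zero q]
      congr 1
      have := choose_two_mul_two j
      push_cast
      linear_combination this
    have h3 : ((-1 : ℝ) ^ j) * (-1) ^ j = 1 := by rw [← mul_pow]; simp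
    generalize q ^ ((j.choose 2 : ℤ) - ((j : ℤ) + (0 : ℕ)) * j) = E at *
    calc _ = qPoch (-p * q ^ j) q j / qPoch (q ^ (-(N : ℤ))) q j *
          (E * q ^ j * q ^ j.choose 2) * ((-1) ^ j * (-1) ^ j) *
          (qPoch q q j / qPoch q q j) := by ring
      _ = _ := by rw [h2, h3, div_self hP, mul_one, mul_one, mul_one]
  · intro s hs
    rw [coeff_C_mul, coeff_eq_zero_of_natDegree_lt, mul_zero]
    exact (natDegree_prod_one_sub_X_mul_C_le q s).trans_lt (Finset.mem_range.1 hs)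

theorem krawtchoukLead_ne_zero (hq0 : 0 < q) (hq1 : q ≠ 1) (hp : 0 < p) {N j : ℕ} (hj : j ≤ N) :
    krawtchoukLead p N q j ≠ 0 := by
  refine div_ne_zero ?_ (qPoch_zpow_neg_ne_zero hq0 hq1 hj)
  rw [neg_mul]
  exact (qPoch_pos_of_neg hq0 (by positivity) _).ne'

/-- Against a polynomial of degree at most `j`, only the coefficient of `z ^ j` contributes. -/
theorem sum_weight_qKrawtchouk_eval (hq0 : 0 < q) (hq1 : q ≠ 1) (hp : 0 < p) {j N : ℕ}
    (hj : j ≤ N) {P : ℝ[X]} (hP : P.natDegree ≤ j) :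
    ∑ x ∈ Finset.range (N + 1), qKrawtchoukWeight p N q x *
        qKrawtchouk j (q ^ (-(x : ℤ))) p N q * P.eval (q ^ (-(x : ℤ))) =
      P.coeff j * ∑ x ∈ Finset.range (N + 1), qKrawtchoukWeight p N q x *
        qKrawtchouk j (q ^ (-(x : ℤ))) p N q * (q ^ (-(x : ℤ))) ^ j := by
  have h0 : ∀ m < j, ∑ x ∈ Finset.range (N + 1), qKrawtchoukWeight p N q x *
      qKrawtchouk j (q ^ (-(x : ℤ))) p N q * (q ^ (-(x : ℤ))) ^ m = 0 := by
    intro m hm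
    rw [sum_weight_qKrawtchouk hq0 hq1 hp hj, mul_eq_zero]
    refine Or.inr (Finset.prod_eq_zero_iff.2 ⟨j - 1 - m, Finset.mem_range.2 (by omega), ?_⟩)
    rw [neg_mul, neg_mul, mul_assoc, ← pow_add, show m + 1 + (j - 1 - m) = j by omega, sub_self]
  calc _ = ∑ m ∈ Finset.range (j + 1), P.coeff m * ∑ x ∈ Finset.range (N + 1),
        qKrawtchoukWeight p N q x *
          qKrawtchouk j (q ^ (-(x : ℤ))) p N q * (q ^ (-(x : ℤ))) ^ m := by
        simp only [eval_eq_sum_range' (Nat.lt_succ_of_le hP), Finset.mul_sum]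
        rw [Finset.sum_comm]
        exact Finset.sum_congr rfl fun m _ => Finset.sum_congr rfl fun x _ => by ring
    _ = _ := by
        rw [Finset.sum_range_succ, Finset.sum_eq_zero, zero_add]
        intro m hm
        rw [h0 m (Finset.mem_range.1 hm), mul_zero]

/-- The squared norm of the monic `q`-Krawtchouk polynomial of degree `j`. -/
noncomputable def monicNormSq (p : ℝ) (N : ℕ) (q : ℝ) (j : ℕ) : ℝ :=
  p ^ ((j : ℤ) - N) *
    q ^ ((j : ℤ) ^ 2 + j.choose 2 - 2 * j * N - ((N + 1).choose 2 : ℤ)) *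
    (qPoch (-(p * q ^ (2 * j + 1))) q (N - j) / qPoch (-(p * q ^ j)) q j) *
    (qPoch q q j * qPoch q q N / qPoch q q (N - j))

theorem sum_weight_qKrawtchouk_pow_self (hq0 : 0 < q) (hq1 : q ≠ 1) (hp : 0 < p) {j N : ℕ}
    (hj : j ≤ N) :
    ∑ x ∈ Finset.range (N + 1), qKrawtchoukWeight p N q x *
        qKrawtchouk j (q ^ (-(x : ℤ))) p N q * (q ^ (-(x : ℤ))) ^ j =
      krawtchoukLead p N q j * monicNormSq p N q j := by
  have hq : q ≠ 0 := hq0.ne'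
  obtain ⟨r, rfl⟩ := Nat.exists_eq_add_of_le hj
  rw [sum_weight_qKrawtchouk hq0 hq1 hp hj, krawtchoukLead, monicNormSq, Nat.add_sub_cancel_left]
  have h1 : ∏ i ∈ Finset.range j, (-p * q ^ j - -(p * q ^ (j + 1)) * q ^ i) =
      (-1) ^ j * p ^ j * q ^ (j * j) * qPoch q q j := by
    rw [qPoch, pow_mul, ← mul_pow, ← mul_pow]
    rw [show (-1 * p * q ^ j) ^ j = ∏ _i ∈ Finset.range j, (-1 * p * q ^ j) by simp,
      ← Finset.prod_mul_distrib]
    exact Finset.prod_congr rfl fun i _ => by ring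
  have hA : qPoch (-p * q ^ j) q j ≠ 0 := by
    rw [neg_mul]; exact (qPoch_pos_of_neg hq0 (by positivity) _).ne'
  have hB := qPoch_zpow_neg_ne_zero hq0 hq1 hj
  have hP := qPoch_self_ne_zero hq0 hq1
  have h2 := qPoch_zpow_neg hq0 j r
  have h3 : p ^ (-((j + r : ℕ) : ℤ)) * p ^ j = p ^ ((j : ℤ) - (j + r : ℕ)) := by
    rw [← zpow_natCast, ← zpow_add₀ hp.ne']; congr 1; push_cast; ring
  have h4 : q ^ (-((j : ℤ) * ((j + r : ℕ) : ℤ)) - ((j + r + 1).choose 2 : ℤ)) * q ^ (j * j) *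
        q ^ ((j.choose 2 : ℤ) - (j + r) * j) =
      q ^ ((j : ℤ) ^ 2 + j.choose 2 - 2 * j * (j + r : ℕ) - ((j + r + 1).choose 2 : ℤ)) := by
    rw [← zpow_natCast, ← zpow_add₀ hq, ← zpow_add₀ hq]; congr 1; push_cast; ring
  rw [h1, ← h3, ← h4, show j + 1 + j = 2 * j + 1 by ring, ← neg_mul p (q ^ j)]
  generalize qPoch (-p * q ^ j) q j = A at *
  generalize qPoch (q ^ (-((j + r : ℕ) : ℤ))) q j = B at *
  have h5 := hP r
  have h6 : (-1 : ℝ) ^ j * (-1) ^ j = 1 := by rw [← mul_pow]; simp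
  generalize qPoch (-(p * q ^ (2 * j + 1))) q r = W
  generalize q ^ ((j.choose 2 : ℤ) - (j + r) * j) = E at *
  field_simp
  linear_combination W * qPoch q q j * (-1 : ℝ) ^ j * h2 +
    W * qPoch q q j * E * qPoch q q (j + r) * h6

theorem sum_weight_qKrawtchouk_sq (hq0 : 0 < q) (hq1 : q ≠ 1) (hp : 0 < p) {j N : ℕ}
    (hj : j ≤ N) :
    ∑ x ∈ Finset.range (N + 1), qKrawtchoukWeight p N q x *
        qKrawtchouk j (q ^ (-(x : ℤ))) p N q ^ 2 =
      krawtchoukLead p N q j ^ 2 * monicNormSq p N q j := by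
  have h := sum_weight_qKrawtchouk_eval hq0 hq1 hp hj (natDegree_krawtchoukPoly_le p N q j)
  rw [coeff_krawtchoukPoly hq0 hq1, sum_weight_qKrawtchouk_pow_self hq0 hq1 hp hj] at h
  simp only [eval_krawtchoukPoly] at h
  rw [pow_two, mul_assoc, ← h]
  exact Finset.sum_congr rfl fun x _ => by ring

theorem monicNormSq_pos (hq0 : 0 < q) (hq1 : q ≠ 1) (hp : 0 < p) {j N : ℕ} (hj : j ≤ N) :
    0 < monicNormSq p N q j := by
  have hne : monicNormSq p N q j ≠ 0 := by
    have hP := qPoch_self_ne_zero hq0 hq1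
    refine mul_ne_zero (mul_ne_zero (mul_ne_zero (zpow_ne_zero _ hp.ne')
      (zpow_ne_zero _ hq0.ne')) (div_ne_zero ?_ ?_)) (div_ne_zero (mul_ne_zero (hP _) (hP _)) (hP _))
    all_goals exact (qPoch_pos_of_neg hq0 (by positivity) _).ne'
  have h := sum_weight_qKrawtchouk_sq hq0 hq1 hp hj
  have h0 : 0 ≤ krawtchoukLead p N q j ^ 2 * monicNormSq p N q j := by
    rw [← h]
    exact Finset.sum_nonneg fun x _ =>
      mul_nonneg (qKrawtchoukWeight_pos hq0 hq1 hp _ _).le (sq_nonneg _)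
  have hl : 0 < krawtchoukLead p N q j ^ 2 :=
    sq_pos_of_ne_zero (krawtchoukLead_ne_zero hq0 hq1 hp hj)
  exact lt_of_le_of_ne (nonneg_of_mul_nonneg_right h0 hl) hne.symm

theorem normQKrawtchouk_orthonormal (hq0 : 0 < q) (hq1 : q ≠ 1) (hp : 0 < p) {j l N : ℕ}
    (hj : j ≤ N) (hl : l ≤ N) :
    ∑ a ∈ Finset.range (N + 1), qKrawtchoukWeight p N q a *
      normQKrawtchouk j p N q a * normQKrawtchouk l p N q a = if j = l then 1 else 0 := by
  have hlt : ∀ {i m : ℕ}, i ≤ N → m < i → ∑ x ∈ Finset.range (N + 1), qKrawtchoukWeight p N q x *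
      qKrawtchouk i (q ^ (-(x : ℤ))) p N q * qKrawtchouk m (q ^ (-(x : ℤ))) p N q = 0 := by
    intro i m hi hm
    have hd := natDegree_krawtchoukPoly_le p N q m
    have h := sum_weight_qKrawtchouk_eval hq0 hq1 hp hi (hd.trans hm.le)
    rw [coeff_eq_zero_of_natDegree_lt (hd.trans_lt hm), zero_mul] at h
    simpa only [eval_krawtchoukPoly] using h
  have hpull : ∑ a ∈ Finset.range (N + 1), qKrawtchoukWeight p N q a *
        normQKrawtchouk j p N q a * normQKrawtchouk l p N q a =
      (∑ x ∈ Finset.range (N + 1), qKrawtchoukWeight p N q x *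
        qKrawtchouk j (q ^ (-(x : ℤ))) p N q * qKrawtchouk l (q ^ (-(x : ℤ))) p N q) /
      (Real.sqrt (∑ i ∈ Finset.range (N + 1),
        qKrawtchoukWeight p N q i * qKrawtchouk j (q ^ (-(i : ℤ))) p N q ^ 2) *
      Real.sqrt (∑ i ∈ Finset.range (N + 1),
        qKrawtchoukWeight p N q i * qKrawtchouk l (q ^ (-(i : ℤ))) p N q ^ 2)) := by
    rw [Finset.sum_div]
    refine Finset.sum_congr rfl fun a _ => ?_
    rw [normQKrawtchouk, normQKrawtchouk]
    ring
  rw [hpull]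
  rcases lt_trichotomy j l with h | rfl | h
  · rw [if_neg h.ne]
    have := hlt hl h
    rw [show (∑ x ∈ Finset.range (N + 1), qKrawtchoukWeight p N q x *
      qKrawtchouk j (q ^ (-(x : ℤ))) p N q * qKrawtchouk l (q ^ (-(x : ℤ))) p N q) = 0 by
        rw [← this]; exact Finset.sum_congr rfl fun x _ => by ring, zero_div]
  · rw [if_pos rfl]
    have hs : ∑ i ∈ Finset.range (N + 1),
        qKrawtchoukWeight p N q i * qKrawtchouk j (q ^ (-(i : ℤ))) p N q ^ 2 > 0 := by
      rw [sum_weight_qKrawtchouk_sq hq0 hq1 hp hj]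
      exact mul_pos (sq_pos_of_ne_zero (krawtchoukLead_ne_zero hq0 hq1 hp hj))
        (monicNormSq_pos hq0 hq1 hp hj)
    rw [Real.mul_self_sqrt hs.le, div_eq_one_iff_eq hs.ne']
    exact Finset.sum_congr rfl fun x _ => by ring
  · rw [if_neg h.ne', hlt hj h, zero_div]

/-- The determinant of the kernel is a squared Vandermonde determinant: the kernel matrix is
`B * Bᵀ` with `B` the matrix of values of the orthonormal functions. -/
theorem det_cdKernel (hq0 : 0 < q) (hq1 : q ≠ 1) (hp : 0 < p) {n N : ℕ} (hn : n ≤ N + 1)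
    (a : Fin n → ℕ) :
    Matrix.det (Matrix.of fun i j : Fin n =>
        cdKernel (qKrawtchoukWeight p N q) p N q n (a i) (a j)) =
      (∏ i, qKrawtchoukWeight p N q (a i)) *
        (Matrix.vandermonde fun i => q ^ (-(a i : ℤ))).det ^ 2 /
        ∏ l ∈ Finset.range n, monicNormSq p N q l := by
  have hw := fun x => qKrawtchoukWeight_pos hq0 hq1 hp N x
  have hle : ∀ l : Fin n, (l : ℕ) ≤ N := fun l => by omega
  have hL : ∀ l : Fin n, krawtchoukLead p N q l ≠ 0 := fun l =>
    krawtchoukLead_ne_zero hq0 hq1 hp (hle l)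
  have hM : ∀ l : Fin n, 0 < monicNormSq p N q l := fun l => monicNormSq_pos hq0 hq1 hp (hle l)
  -- Monic polynomials proportional to the `q`-Krawtchouk polynomials.
  let P : Fin n → ℝ[X] := fun l => C (krawtchoukLead p N q l)⁻¹ * krawtchoukPoly p N q l
  have hPdeg : ∀ l, (P l).natDegree = l := by
    intro l
    refine le_antisymm ((natDegree_C_mul_le _ _).trans (natDegree_krawtchoukPoly_le p N q l))
      (le_natDegree_of_ne_zero ?_)
    rw [coeff_C_mul, coeff_krawtchoukPoly hq0 hq1, inv_mul_cancel₀ (hL l)]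
    exact one_ne_zero
  have hPmonic : ∀ l, (P l).Monic := by
    intro l
    rw [Monic, leadingCoeff, hPdeg, coeff_C_mul, coeff_krawtchoukPoly hq0 hq1,
      inv_mul_cancel₀ (hL l)]
  let B : Matrix (Fin n) (Fin n) ℝ := Matrix.of fun i l =>
    (P l).eval (q ^ (-(a i : ℤ)))
  have hB : B.det = (Matrix.vandermonde fun i => q ^ (-(a i : ℤ))).det :=
    (Matrix.det_eval_matrixOfPolynomials_eq_det_vandermonde _ P hPdeg hPmonic).symm
  have hK : (Matrix.of fun i j : Fin n =>
        cdKernel (qKrawtchoukWeight p N q) p N q n (a i) (a j)) =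
      Matrix.diagonal (fun i => Real.sqrt (qKrawtchoukWeight p N q (a i))) *
        (B * Matrix.diagonal (fun l : Fin n => (monicNormSq p N q l)⁻¹) * B.transpose) *
        Matrix.diagonal (fun i => Real.sqrt (qKrawtchoukWeight p N q (a i))) := by
    ext i j
    rw [Matrix.mul_diagonal, Matrix.diagonal_mul, Matrix.mul_apply, Matrix.of_apply, cdKernel,
      Real.sqrt_mul (hw _).le, Finset.sum_range, mul_assoc, mul_assoc,
      mul_comm (Real.sqrt (qKrawtchoukWeight p N q (a j)))]
    congr 2
    refine Finset.sum_congr rfl fun l _ => ?_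
    rw [Matrix.mul_diagonal, Matrix.transpose_apply,
      show B i l = (P l).eval (q ^ (-(a i : ℤ))) from rfl,
      show B j l = (P l).eval (q ^ (-(a j : ℤ))) from rfl, eval_mul, eval_mul, eval_C,
      eval_C, eval_krawtchoukPoly, eval_krawtchoukPoly, normQKrawtchouk, normQKrawtchouk,
      div_mul_div_comm, Real.mul_self_sqrt,
      sum_weight_qKrawtchouk_sq hq0 hq1 hp (hle l)]
    · have := (hM l).ne'
      have := hL l
      field_simp
    · rw [sum_weight_qKrawtchouk_sq hq0 hq1 hp (hle l)]
      exact mul_nonneg (sq_nonneg _) (hM l).le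
  rw [hK, Matrix.det_mul, Matrix.det_mul, Matrix.det_mul, Matrix.det_mul, Matrix.det_transpose,
    Matrix.det_diagonal, Matrix.det_diagonal, hB, Finset.prod_inv_distrib,
    ← Finset.prod_range (fun l => monicNormSq p N q l)]
  have hsq : (∏ i, Real.sqrt (qKrawtchoukWeight p N q (a i))) *
      ∏ i, Real.sqrt (qKrawtchoukWeight p N q (a i)) = ∏ i, qKrawtchoukWeight p N q (a i) := by
    rw [← Finset.prod_mul_distrib]
    exact Finset.prod_congr rfl fun i _ => Real.mul_self_sqrt (hw _).le
  rw [← hsq]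
  ring

end Orthogonality

/-! ### The product of the norms -/

section Constant

variable {q p : ℝ}

theorem prod_zpow_eq_zpow_sum (hq : q ≠ 0) {ι : Type*} (s : Finset ι) (g : ι → ℤ) :
    ∏ i ∈ s, q ^ g i = q ^ ∑ i ∈ s, g i := by
  classical
  induction s using Finset.induction_on with
  | empty => simp
  | insert a s ha ih => rw [Finset.prod_insert ha, Finset.sum_insert ha, ih, zpow_add₀ hq]

/-- Passing from `n` to `n + 1` multiplies the right-hand side by exactly one factor of the left-hand
side. -/
theorem prod_qPoch_div_qPoch (hq0 : 0 < q) (hp : 0 < p) {n N : ℕ} (hn : n ≤ N + 1) :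
    ∏ l ∈ Finset.range n, qPoch (-(p * q ^ (2 * l + 1))) q (N - l) / qPoch (-(p * q ^ l)) q l =
      ∏ i ∈ Finset.range n, qPoch (-(p * q ^ (n + i))) q (N + 1 - n) := by
  induction n with
  | zero => simp
  | succ n ih =>
    obtain ⟨r, rfl⟩ : ∃ r, N = n + r := Nat.exists_eq_add_of_le (by omega)
    have hpos := (qPoch_pos_of_neg hq0 (b := p * q ^ n) (by positivity) n).ne'
    have h1 : ∏ i ∈ Finset.range n, qPoch (-(p * q ^ (n + i))) q (n + r + 1 - n) =
        qPoch (-(p * q ^ n)) q n *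
          ∏ i ∈ Finset.range n, qPoch (-(p * q ^ (n + 1 + i))) q r := by
      rw [qPoch, ← Finset.prod_mul_distrib]
      refine Finset.prod_congr rfl fun i _ => ?_
      rw [show n + r + 1 - n = r + 1 by omega, qPoch_succ_left]
      congr 2
      · ring
      · ring
    rw [Finset.prod_range_succ, ih (by omega), h1, Finset.prod_range_succ,
      show n + r + 1 - (n + 1) = r by omega, Nat.add_sub_cancel_left,
      show n + 1 + n = 2 * n + 1 by ring]
    field_simp

/-- The product of the first `n` monic squared norms for `N = n + K` and `p = q ^ (1 - 2n - c)`,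
up to explicit factors; the powers of `q` cancel for every `c`. -/
theorem prod_monicNormSq (hq0 : 0 < q) (hq1 : q ≠ 1) (n K : ℕ) (c : ℤ) :
    ∏ l ∈ Finset.range n, monicNormSq (q ^ (1 - 2 * (n : ℤ) - c)) (n + K) q l *
        (q ^ (((n + K - l).choose 2 : ℤ) - l.choose 2 - c * (l + K + 1)) *
          (qPoch q q (n + K - l) / (qPoch q q l * qPoch q q (n + K)))) =
      ∏ l ∈ Finset.range n, q ^ (l * (K + 1)) *
        qPoch (-(q ^ (1 - 2 * (n : ℤ) - c) * q ^ (n + l))) q (K + 1) := by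
  have hq : q ≠ 0 := hq0.ne'
  have hP := qPoch_self_ne_zero hq0 hq1
  have h1 : ∀ l ∈ Finset.range n, monicNormSq (q ^ (1 - 2 * (n : ℤ) - c)) (n + K) q l *
        (q ^ (((n + K - l).choose 2 : ℤ) - l.choose 2 - c * (l + K + 1)) *
          (qPoch q q (n + K - l) / (qPoch q q l * qPoch q q (n + K)))) =
      q ^ ((1 - 2 * (n : ℤ) - c) * (l - (n + K)) + (l ^ 2 - 2 * l * (n + K) -
        ((n + K + 1).choose 2 : ℤ)) + (n + K - l).choose 2 - c * (l + K + 1)) *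
      (qPoch (-(q ^ (1 - 2 * (n : ℤ) - c) * q ^ (2 * l + 1))) q (n + K - l) /
        qPoch (-(q ^ (1 - 2 * (n : ℤ) - c) * q ^ l)) q l) := by
    intro l _
    have e : (q ^ (1 - 2 * (n : ℤ) - c)) ^ ((l : ℤ) - (n + K : ℕ)) *
        q ^ ((l : ℤ) ^ 2 + l.choose 2 - 2 * l * (n + K : ℕ) - ((n + K + 1).choose 2 : ℤ)) *
        q ^ (((n + K - l).choose 2 : ℤ) - l.choose 2 - c * (l + K + 1)) =
      q ^ ((1 - 2 * (n : ℤ) - c) * (l - (n + K)) + (l ^ 2 - 2 * l * (n + K) -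
        ((n + K + 1).choose 2 : ℤ)) + (n + K - l).choose 2 - c * (l + K + 1)) := by
      rw [← zpow_mul, ← zpow_add₀ hq, ← zpow_add₀ hq]
      congr 1
      push_cast
      ring
    rw [← e, monicNormSq]
    have a1 := hP l
    have a2 := hP (n + K)
    have a3 := hP (n + K - l)
    field_simp
  have h2 : ∀ m ≤ n, 4 * ∑ l ∈ Finset.range m, ((1 - 2 * (n : ℤ) - c) * (l - (n + K)) +
        (l ^ 2 - 2 * l * (n + K) - ((n + K + 1).choose 2 : ℤ)) + (n + K - l).choose 2 -
        c * (l + K + 1) - l * (K + 1)) =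
      2 * m ^ 3 - 3 * m ^ 2 + m + (3 - 4 * n - 6 * (n + K) - 2 * (K + 1)) * (m ^ 2 - m) +
        8 * m * (n - 1) * (n + K) - 4 * c * (m ^ 2 - m + m * (1 - n)) := by
    intro m
    induction m with
    | zero => simp
    | succ m ih =>
      intro hm
      rw [Finset.sum_range_succ, mul_add, ih (by omega)]
      have b1 := choose_two_mul_two (n + K + 1)
      have b2 := choose_two_mul_two (n + K - m)
      have b3 : ((n + K - m : ℕ) : ℤ) = n + K - m := by push_cast [show m ≤ n + K by omega]; ring
      rw [b3] at b2
      push_cast at b1 ⊢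
      linear_combination -2 * b1 + 2 * b2
  have h3 : ∑ l ∈ Finset.range n, ((1 - 2 * (n : ℤ) - c) * (l - (n + K)) +
        (l ^ 2 - 2 * l * (n + K) - ((n + K + 1).choose 2 : ℤ)) + (n + K - l).choose 2 -
        c * (l + K + 1)) = ∑ l ∈ Finset.range n, (l * (K + 1) : ℤ) := by
    have := h2 n le_rfl
    rw [Finset.sum_sub_distrib] at this
    refine sub_eq_zero.1 ((mul_eq_zero.1 (this.trans ?_)).resolve_left four_ne_zero)
    ring
  rw [Finset.prod_congr rfl h1, Finset.prod_mul_distrib, Finset.prod_mul_distrib,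
    prod_qPoch_div_qPoch hq0 (by positivity) (by omega), show n + K + 1 - n = K + 1 by omega,
    prod_zpow_eq_zpow_sum hq, h3, ← prod_zpow_eq_zpow_sum hq]
  congr 1

theorem prod_monicNormSq_self (hq0 : 0 < q) (hq1 : q ≠ 1) (n K : ℕ) :
    ∏ l ∈ Finset.range n, monicNormSq (q ^ (1 - 2 * (n : ℤ))) (n + K) q l *
        (q ^ (((n + K - l).choose 2 : ℤ) - l.choose 2) *
          (qPoch q q (n + K - l) / (qPoch q q l * qPoch q q (n + K)))) =
      ∏ i : Fin n, ∏ j : Fin (K + 1), (q ^ (i : ℕ) + q ^ (j : ℕ)) := by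
  have hq : q ≠ 0 := hq0.ne'
  have h := prod_monicNormSq hq0 hq1 n K 0
  simp only [sub_zero, zero_mul] at h
  rw [h, Finset.prod_mul_distrib, ← Finset.prod_range_reflect
    (fun l => qPoch (-(q ^ (1 - 2 * (n : ℤ)) * q ^ (n + l))) q (K + 1)),
    ← Finset.prod_mul_distrib, Finset.prod_range]
  refine Finset.prod_congr rfl fun i _ => ?_
  rw [qPoch, pow_mul, show (q ^ (i : ℕ)) ^ (K + 1) = ∏ _j ∈ Finset.range (K + 1), q ^ (i : ℕ) by
    simp, ← Finset.prod_mul_distrib, Finset.prod_range]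
  refine Finset.prod_congr rfl fun j _ => ?_
  have h1 : q ^ (i : ℕ) * (q ^ (1 - 2 * (n : ℤ)) * q ^ (n + (n - 1 - i))) = 1 := by
    rw [← zpow_natCast q, ← zpow_natCast q, ← zpow_add₀ hq, ← zpow_add₀ hq, ← zpow_zero q]
    congr 1
    have := i.2
    omega
  linear_combination q ^ (j : ℕ) * h1

theorem prod_monicNormSq_inv (hq0 : 0 < q) (hq1 : q ≠ 1) (n K : ℕ) :
    ∏ l ∈ Finset.range n, monicNormSq (q ^ (1 - 2 * (n : ℤ) - K)) (n + K) q l *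
        (q ^ (((n + K - l).choose 2 : ℤ) - l.choose 2 - K * (l + K + 1)) *
          (qPoch q q (n + K - l) / (qPoch q q l * qPoch q q (n + K)))) =
      ∏ i : Fin n, ∏ j : Fin (K + 1), (q ^ (i : ℕ) + q ^ (-((j : ℕ) : ℤ))) := by
  have hq : q ≠ 0 := hq0.ne'
  rw [prod_monicNormSq hq0 hq1 n K K, Finset.prod_mul_distrib, ← Finset.prod_range_reflect
    (fun l => qPoch (-(q ^ (1 - 2 * (n : ℤ) - K) * q ^ (n + l))) q (K + 1)),
    ← Finset.prod_mul_distrib, Finset.prod_range]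
  refine Finset.prod_congr rfl fun i _ => ?_
  rw [qPoch, ← Finset.prod_range_reflect, pow_mul,
    show (q ^ (i : ℕ)) ^ (K + 1) = ∏ _j ∈ Finset.range (K + 1), q ^ (i : ℕ) by simp,
    ← Finset.prod_mul_distrib, Finset.prod_range]
  refine Finset.prod_congr rfl fun j _ => ?_
  have h1 : q ^ (i : ℕ) * (q ^ (1 - 2 * (n : ℤ) - K) * q ^ (n + (n - 1 - i))) *
      q ^ (K + 1 - 1 - j) = q ^ (-((j : ℕ) : ℤ)) := by
    rw [← zpow_natCast q, ← zpow_natCast q, ← zpow_natCast q, ← zpow_add₀ hq, ← zpow_add₀ hq,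
      ← zpow_add₀ hq]
    congr 1
    have := i.2
    have := j.2
    omega
  linear_combination h1

end Constant

/-! ### Branching of Schur polynomials -/

section Branching

theorem YoungDiagram_ext_rowLen {lam mu : YoungDiagram}
    (h : ∀ i, lam.rowLen i = mu.rowLen i) : lam = mu := by
  apply YoungDiagram.ext
  ext ⟨i, j⟩
  rw [YoungDiagram.mem_cells, YoungDiagram.mem_cells, YoungDiagram.mem_iff_lt_rowLen,
    YoungDiagram.mem_iff_lt_rowLen, h]

theorem rowLen_eq_zero {lam : YoungDiagram} {m : ℕ} (h : ∀ c ∈ lam, c.1 < m) {i : ℕ}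
    (hi : m ≤ i) : lam.rowLen i = 0 := by
  by_contra h0
  have := h (i, 0) (YoungDiagram.mem_iff_lt_rowLen.2 (Nat.pos_of_ne_zero h0))
  simp only at this
  omega

theorem card_cells_eq_sum_rowLen {lam : YoungDiagram} {m : ℕ} (h : ∀ c ∈ lam, c.1 < m) :
    lam.cells.card = ∑ i : Fin m, lam.rowLen i := by
  rw [Finset.card_eq_sum_card_fiberwise (f := Prod.fst) (t := Finset.range m)
    (fun c hc => Finset.mem_coe.2 (Finset.mem_range.2 (h c ((YoungDiagram.mem_cells c).1 hc)))),
    ← Finset.sum_range (fun i => lam.rowLen i)]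
  exact Finset.sum_congr rfl fun i _ => (lam.rowLen_eq_card).symm

/-- The Young diagram with at most `m` rows whose row lengths are `b`, when `b` is weakly
decreasing; in general the row lengths are the running minima of `b`. -/
def ofRows {m : ℕ} (b : Fin m → ℕ) : YoungDiagram where
  cells := (Finset.range m ×ˢ Finset.range (Finset.univ.sup b)).filter
    (fun c => ∀ i : Fin m, (i : ℕ) ≤ c.1 → c.2 < b i)
  isLowerSet := by
    rintro ⟨i, j⟩ ⟨i', j'⟩ hle h
    have h1 : i' ≤ i := hle.1
    have h2 : j' ≤ j := hle.2
    simp only [Finset.coe_filter, Finset.mem_product, Finset.mem_range, Set.mem_ofPred_eq] at h ⊢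
    exact ⟨⟨by omega, by omega⟩, fun l hl => h2.trans_lt (h.2 l (hl.trans h1))⟩

theorem mem_ofRows {m : ℕ} {b : Fin m → ℕ} {i j : ℕ} :
    (i, j) ∈ ofRows b ↔ i < m ∧ ∀ l : Fin m, (l : ℕ) ≤ i → j < b l := by
  rw [← YoungDiagram.mem_cells, ofRows, Finset.mem_filter, Finset.mem_product, Finset.mem_range,
    Finset.mem_range]
  refine ⟨fun h => ⟨h.1.1, h.2⟩, fun h => ⟨⟨h.1, ?_⟩, h.2⟩⟩
  exact (h.2 ⟨i, h.1⟩ le_rfl).trans_le (Finset.le_sup (f := b) (Finset.mem_univ _))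

theorem ofRows_fst_lt {m : ℕ} {b : Fin m → ℕ} : ∀ c ∈ ofRows b, c.1 < m :=
  fun _ hc => (mem_ofRows.1 hc).1

theorem rowLen_ofRows {m : ℕ} {b : Fin m → ℕ} (hb : Antitone b) (i : Fin m) :
    (ofRows b).rowLen i = b i := by
  refine eq_of_forall_lt_iff fun j => ?_
  rw [← YoungDiagram.mem_iff_lt_rowLen, mem_ofRows]
  exact ⟨fun h => h.2 i le_rfl, fun h => ⟨i.2, fun l hl => h.trans_le (hb hl)⟩⟩

theorem ofRows_rowLen {lam : YoungDiagram} {m : ℕ} (h : ∀ c ∈ lam, c.1 < m) :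
    ofRows (fun i : Fin m => lam.rowLen i) = lam := by
  refine YoungDiagram_ext_rowLen fun i => ?_
  by_cases hi : i < m
  · exact rowLen_ofRows (fun a b hab => lam.rowLen_anti _ _ hab) ⟨i, hi⟩
  · rw [rowLen_eq_zero h (not_lt.1 hi), rowLen_eq_zero ofRows_fst_lt (not_lt.1 hi)]

/-- In column-strict tableaux the entries of row `i` are at least `i`. -/
theorem le_entry {mu : YoungDiagram} (T : SemistandardYoungTableau mu) {i j : ℕ}
    (h : (i, j) ∈ mu) : i ≤ T i j := by
  induction i with
  | zero => exact Nat.zero_le _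
  | succ i ih =>
    exact (ih (mu.up_left_mem (Nat.le_succ i) le_rfl h)).trans_lt (T.col_strict (Nat.lt_succ_self i) h)

theorem schur_eq_sum (mu : YoungDiagram) {m : ℕ} (x : Fin m → ℝ) :
    schur mu x = ∑ T : SSYT mu m, ∏ i : Fin m, x i ^ content T i := by
  simp [schur, schurPoly]

variable {lam : YoungDiagram} {m : ℕ}

/-- The shape formed by the entries of `T` other than the largest letter. -/
def subshape (T : SSYT lam (m + 1)) : YoungDiagram where
  cells := lam.cells.filter (fun c => T.1 c.1 c.2 < m)
  isLowerSet := by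
    rintro ⟨i, j⟩ ⟨i', j'⟩ hle h
    have h1 : i' ≤ i := hle.1
    have h2 : j' ≤ j := hle.2
    simp only [Finset.coe_filter, YoungDiagram.mem_cells, Set.mem_ofPred_eq] at h ⊢
    refine ⟨lam.up_left_mem h1 h2 h.1, ?_⟩
    exact ((T.1.row_weak_of_le h2 (lam.up_left_mem h1 le_rfl h.1)).trans
      (T.1.col_weak h1 h.1)).trans_lt h.2

theorem mem_subshape {T : SSYT lam (m + 1)} {c : ℕ × ℕ} :
    c ∈ subshape T ↔ c ∈ lam ∧ T.1 c.1 c.2 < m := by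
  rw [← YoungDiagram.mem_cells, subshape, Finset.mem_filter, YoungDiagram.mem_cells]

theorem subshape_fst_lt (T : SSYT lam (m + 1)) : ∀ c ∈ subshape T, c.1 < m := fun _ hc =>
  (le_entry T.1 (mem_subshape.1 hc).1).trans_lt (mem_subshape.1 hc).2

/-- The row lengths of `subshape T`. -/
def subrows (T : SSYT lam (m + 1)) (i : Fin m) : ℕ := (subshape T).rowLen i

theorem ofRows_subrows (T : SSYT lam (m + 1)) : ofRows (subrows T) = subshape T :=
  ofRows_rowLen (subshape_fst_lt T)

theorem subrows_mem (T : SSYT lam (m + 1)) :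
    subrows T ∈ Fintype.piFinset fun i : Fin m =>
      Finset.Icc (lam.rowLen (i + 1)) (lam.rowLen i) := by
  refine Fintype.mem_piFinset.2 fun i => Finset.mem_Icc.2 ⟨?_, ?_⟩
  · refine le_of_forall_lt fun j hj => ?_
    have hj' := YoungDiagram.mem_iff_lt_rowLen.2 hj
    refine YoungDiagram.mem_iff_lt_rowLen.1 (mem_subshape.2
      ⟨lam.up_left_mem (Nat.le_succ _) le_rfl hj', ?_⟩)
    exact (T.1.col_strict (Nat.lt_succ_self _) hj').trans_le (Nat.lt_succ_iff.1 (T.2 _ hj'))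
  · refine le_of_forall_lt fun j hj => ?_
    exact YoungDiagram.mem_iff_lt_rowLen.1
      (mem_subshape.1 (YoungDiagram.mem_iff_lt_rowLen.2 hj)).1

/-- The restriction of a tableau to a smaller shape with smaller entries. -/
def restrictSSYT (T : SSYT lam (m + 1)) (mu : YoungDiagram) (h : mu = subshape T) :
    SSYT mu m :=
  ⟨{ entry := fun i j => if (i, j) ∈ mu then T.1 i j else 0
     row_weak' := by
       intro i j1 j2 hj hc
       rw [if_pos hc, if_pos (mu.up_left_mem le_rfl hj.le hc)]
       exact T.1.row_weak hj (mem_subshape.1 (h ▸ hc)).1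
     col_strict' := by
       intro i1 i2 j hi hc
       rw [if_pos hc, if_pos (mu.up_left_mem hi.le le_rfl hc)]
       exact T.1.col_strict hi (mem_subshape.1 (h ▸ hc)).1
     zeros' := fun hc => if_neg hc }, by
    intro c hc
    change (if (c.1, c.2) ∈ mu then T.1 c.1 c.2 else 0) < m
    rw [if_pos hc]
    exact (mem_subshape.1 (h ▸ hc)).2⟩

theorem restrictSSYT_apply (T : SSYT lam (m + 1)) (mu : YoungDiagram) (h : mu = subshape T)
    (i j : ℕ) : (restrictSSYT T mu h).1 i j = if (i, j) ∈ mu then T.1 i j else 0 := rfl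

/-- The extension of a tableau by the largest letter, along a horizontal strip. -/
def extendSSYT {mu : YoungDiagram} (S : SSYT mu m) (hle : mu ≤ lam)
    (hstrip : ∀ i j, (i + 1, j) ∈ lam → (i, j) ∈ mu) : SSYT lam (m + 1) :=
  ⟨{ entry := fun i j => if (i, j) ∈ mu then S.1 i j else if (i, j) ∈ lam then m else 0
     row_weak' := by
       intro i j1 j2 hj hc
       by_cases h2 : (i, j2) ∈ mu
       · rw [if_pos h2, if_pos (mu.up_left_mem le_rfl hj.le h2)]
         exact S.1.row_weak hj h2
       · rw [if_neg h2, if_pos hc]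
         split_ifs with h3 h4
         · exact (S.2 _ h3).le
         · exact le_rfl
         · exact Nat.zero_le _
     col_strict' := by
       intro i1 i2 j hi hc
       have h1 : (i1, j) ∈ mu :=
         hstrip i1 j (lam.up_left_mem (Nat.succ_le_of_lt hi) le_rfl hc)
       rw [if_pos h1]
       by_cases h2 : (i2, j) ∈ mu
       · rw [if_pos h2]
         exact S.1.col_strict hi h2
       · rw [if_neg h2, if_pos hc]
         exact S.2 _ h1
     zeros' := by
       intro i j hc
       rw [if_neg (fun h => hc (hle h)), if_neg hc] }, by
    intro c hc
    change (if (c.1, c.2) ∈ mu then S.1 c.1 c.2 else if (c.1, c.2) ∈ lam then m else 0) < m + 1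
    split_ifs with h
    · exact (S.2 _ h).trans (Nat.lt_succ_self m)
    · exact Nat.lt_succ_self m⟩

theorem extendSSYT_apply {mu : YoungDiagram} (S : SSYT mu m) (hle : mu ≤ lam)
    (hstrip : ∀ i j, (i + 1, j) ∈ lam → (i, j) ∈ mu) (i j : ℕ) :
    (extendSSYT S hle hstrip).1 i j =
      if (i, j) ∈ mu then S.1 i j else if (i, j) ∈ lam then m else 0 := rfl

theorem subshape_extendSSYT {mu : YoungDiagram} (S : SSYT mu m) (hle : mu ≤ lam)
    (hstrip : ∀ i j, (i + 1, j) ∈ lam → (i, j) ∈ mu) :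
    subshape (extendSSYT S hle hstrip) = mu := by
  apply YoungDiagram.ext
  ext ⟨i, j⟩
  rw [YoungDiagram.mem_cells, YoungDiagram.mem_cells, mem_subshape, extendSSYT_apply]
  constructor
  · rintro ⟨h1, h2⟩
    by_contra h3
    rw [if_neg h3, if_pos h1] at h2
    exact lt_irrefl _ h2
  · intro h
    rw [if_pos h]
    exact ⟨hle h, S.2 _ h⟩

theorem content_castSucc (T : SSYT lam (m + 1)) (mu : YoungDiagram) (h : mu = subshape T)
    (i : Fin m) : content T i.castSucc = content (restrictSSYT T mu h) i := by
  unfold content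
  congr 1
  ext c
  rw [Finset.mem_filter, Finset.mem_filter, YoungDiagram.mem_cells, YoungDiagram.mem_cells,
    restrictSSYT_apply, Fin.val_castSucc]
  constructor
  · rintro ⟨h1, h2⟩
    have h3 : c ∈ mu := h ▸ mem_subshape.2 ⟨h1, h2 ▸ i.2⟩
    exact ⟨h3, by rw [if_pos h3, h2]⟩
  · rintro ⟨h1, h2⟩
    rw [if_pos h1] at h2
    exact ⟨(mem_subshape.1 (h ▸ h1)).1, h2⟩

theorem content_last (hlam : ∀ c ∈ lam, c.1 < m + 1) (T : SSYT lam (m + 1)) :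
    content T (Fin.last m) =
      lam.rowLen m + ∑ i : Fin m, (lam.rowLen i - subrows T i) := by
  have h1 := Finset.card_filter_add_card_filter_not (s := lam.cells)
    (fun c => T.1 c.1 c.2 < m)
  have h2 : (lam.cells.filter fun c => ¬ T.1 c.1 c.2 < m).card = content T (Fin.last m) := by
    unfold content
    congr 1
    refine Finset.filter_congr fun c hc => ?_
    have := T.2 c ((YoungDiagram.mem_cells c).1 hc)
    simp only [Fin.val_last]
    omega
  have h3 : (lam.cells.filter fun c => T.1 c.1 c.2 < m).card = ∑ i : Fin m, subrows T i :=
    card_cells_eq_sum_rowLen (subshape_fst_lt T)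
  rw [h2, h3, card_cells_eq_sum_rowLen hlam, Fin.sum_univ_castSucc] at h1
  have h4 : ∑ i : Fin m, (lam.rowLen i - subrows T i) + ∑ i : Fin m, subrows T i =
      ∑ i : Fin m, lam.rowLen i := by
    rw [← Finset.sum_add_distrib]
    refine Finset.sum_congr rfl fun i _ => Nat.sub_add_cancel ?_
    exact (Finset.mem_Icc.1 (Fintype.mem_piFinset.1 (subrows_mem T) i)).2
  simp only [Fin.val_castSucc, Fin.val_last] at h1
  omega

/-- The branching rule: the letters `m` of a tableau form a horizontal strip. -/
theorem schur_branching (hlam : ∀ c ∈ lam, c.1 < m + 1) (x : Fin (m + 1) → ℝ) :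
    schur lam x = ∑ b ∈ Fintype.piFinset fun i : Fin m =>
        Finset.Icc (lam.rowLen (i + 1)) (lam.rowLen i),
      schur (ofRows b) (fun i => x i.castSucc) *
        x (Fin.last m) ^ (lam.rowLen m + ∑ i : Fin m, (lam.rowLen i - b i)) := by
  rw [schur_eq_sum, ← Finset.sum_fiberwise_of_maps_to (g := subrows)
    (fun T _ => subrows_mem T)]
  refine Finset.sum_congr rfl fun b hb => ?_
  have hb' := fun i => Finset.mem_Icc.1 (Fintype.mem_piFinset.1 hb i)
  have hanti : Antitone b := by
    intro i j hij
    rcases hij.eq_or_lt with rfl | h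
    · exact le_rfl
    · exact (hb' j).2.trans ((lam.rowLen_anti _ _ (Nat.succ_le_of_lt h)).trans (hb' i).1)
  have hle : ofRows b ≤ lam := by
    rintro ⟨i, j⟩ hc
    obtain ⟨h1, h2⟩ := mem_ofRows.1 hc
    exact YoungDiagram.mem_iff_lt_rowLen.2 ((h2 ⟨i, h1⟩ le_rfl).trans_le (hb' ⟨i, h1⟩).2)
  have hstrip : ∀ i j, (i + 1, j) ∈ lam → (i, j) ∈ ofRows b := by
    intro i j hc
    have hi : i < m := by have := hlam _ hc; simp only at this; omega
    refine mem_ofRows.2 ⟨hi, fun l hl => ?_⟩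
    exact (YoungDiagram.mem_iff_lt_rowLen.1 hc).trans_le ((hb' ⟨i, hi⟩).1.trans (hanti hl))
  have hrow : ∀ S : SSYT (ofRows b) m, subrows (extendSSYT S hle hstrip) = b := by
    intro S
    funext i
    rw [subrows, subshape_extendSSYT, rowLen_ofRows hanti]
  have hsub : ∀ T ∈ Finset.univ.filter (fun T : SSYT lam (m + 1) => subrows T = b),
      ofRows b = subshape T := by
    intro T hT
    rw [← (Finset.mem_filter.1 hT).2, ofRows_subrows]
  rw [schur_eq_sum, Finset.sum_mul]
  refine Finset.sum_bij' (fun T hT => restrictSSYT T (ofRows b) (hsub T hT))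
    (fun S _ => extendSSYT S hle hstrip) (fun _ _ => Finset.mem_univ _)
    (fun S _ => Finset.mem_filter.2 ⟨Finset.mem_univ _, hrow S⟩) ?_ ?_ ?_
  · intro T hT
    apply Subtype.ext
    apply SemistandardYoungTableau.ext
    intro i j
    rw [extendSSYT_apply, restrictSSYT_apply]
    by_cases h1 : (i, j) ∈ ofRows b
    · rw [if_pos h1, if_pos h1]
    · rw [if_neg h1]
      split_ifs with h2
      · have h3 : ¬ T.1 i j < m := fun h => h1 (hsub T hT ▸ mem_subshape.2 ⟨h2, h⟩)
        have := T.2 _ h2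
        simp only at this
        omega
      · exact (T.1.zeros h2).symm
  · intro S _
    apply Subtype.ext
    apply SemistandardYoungTableau.ext
    intro i j
    rw [restrictSSYT_apply, extendSSYT_apply]
    split_ifs with h1
    · rfl
    · exact (S.1.zeros h1).symm
  · intro T hT
    rw [Fin.prod_univ_castSucc, content_last hlam, (Finset.mem_filter.1 hT).2]
    congr 1
    exact Finset.prod_congr rfl fun i _ => by rw [content_castSucc]

end Branching

/-! ### The bialternant formula -/

section Bialternant

/-- The alternant `det (x_i ^ α_j)`. -/
noncomputable def alternant {m : ℕ} (x : Fin m → ℝ) (α : Fin m → ℕ) : ℝ :=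
  Matrix.det (Matrix.of fun i j => x i ^ α j)

/-- The branching rule for alternants: subtract from each column a multiple of the preceding one, so
that the last row vanishes except in the first column. -/
theorem alternant_branching {m : ℕ} (x : Fin (m + 1) → ℝ) {α : Fin (m + 1) → ℕ}
    (hα : ∀ j : Fin m, α j.castSucc ≤ α j.succ) :
    alternant x α = (-1) ^ m * x (Fin.last m) ^ α 0 *
      (∏ i : Fin m, (x i.castSucc - x (Fin.last m))) *
      ∑ b ∈ Fintype.piFinset fun j : Fin m => Finset.Ico (α j.castSucc) (α j.succ),
        (∏ j : Fin m, x (Fin.last m) ^ (α j.succ - 1 - b j)) *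
          alternant (fun i => x i.castSucc) b := by
  set c := x (Fin.last m) with hc
  let B : Matrix (Fin (m + 1)) (Fin (m + 1)) ℝ := Matrix.of fun i =>
    Fin.cons (x i ^ α 0) fun j : Fin m =>
      x i ^ α j.succ - x i ^ α j.castSucc * c ^ (α j.succ - α j.castSucc)
  have h1 : alternant x α = B.det := by
    refine Matrix.det_eq_of_forall_col_eq_smul_add_pred
      (fun j : Fin m => c ^ (α j.succ - α j.castSucc)) (fun i => rfl) fun i j => ?_
    change x i ^ α j.succ = x i ^ α j.succ - x i ^ α j.castSucc * c ^ (α j.succ - α j.castSucc) +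
      c ^ (α j.succ - α j.castSucc) * x i ^ α j.castSucc
    ring
  have hlast : ∀ j : Fin m, B (Fin.last m) j.succ = 0 := by
    intro j
    change c ^ α j.succ - c ^ α j.castSucc * c ^ (α j.succ - α j.castSucc) = 0
    rw [← pow_add, Nat.add_sub_cancel' (hα j), sub_self]
  have h2 : B.submatrix (Fin.last m).succAbove (0 : Fin (m + 1)).succAbove =
      Matrix.of fun i j : Fin m => (x i.castSucc - c) *
        (Matrix.of fun i j : Fin m => ∑ b ∈ Finset.Ico (α j.castSucc) (α j.succ),
          x i.castSucc ^ b * c ^ (α j.succ - 1 - b)) i j := by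
    ext i j
    rw [Matrix.submatrix_apply, Fin.succAbove_last, Fin.succAbove_zero, Matrix.of_apply,
      Matrix.of_apply, mul_geom_sum₂_Ico _ _ (hα j)]
    rfl
  have h3 : Matrix.det (Matrix.of fun i j : Fin m =>
        ∑ b ∈ Finset.Ico (α j.castSucc) (α j.succ),
          x i.castSucc ^ b * c ^ (α j.succ - 1 - b)) =
      ∑ b ∈ Fintype.piFinset fun j : Fin m => Finset.Ico (α j.castSucc) (α j.succ),
        (∏ j : Fin m, c ^ (α j.succ - 1 - b j)) * alternant (fun i => x i.castSucc) b := by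
    rw [← Matrix.det_transpose]
    have := (Matrix.detRowAlternating (n := Fin m) (R := ℝ)).toMultilinearMap.map_sum_finset
      (fun j b => fun i : Fin m => x i.castSucc ^ b * c ^ (α j.succ - 1 - b))
      (fun j : Fin m => Finset.Ico (α j.castSucc) (α j.succ))
    refine Eq.trans ?_ (this.trans (Finset.sum_congr rfl fun b _ => ?_))
    · change Matrix.det _ = Matrix.det _
      congr 1
      ext j i
      rw [Finset.sum_apply]
      rfl
    · rw [alternant, ← Matrix.det_mul_row, ← Matrix.det_transpose]
      change Matrix.det _ = Matrix.det _
      congr 1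
      ext j i
      exact mul_comm _ _
  rw [h1, Matrix.det_succ_row B (Fin.last m), Fin.sum_univ_succ, Finset.sum_eq_zero, add_zero, h2,
    Matrix.det_mul_column, h3, Fin.val_last, Fin.val_zero, add_zero,
    show B (Fin.last m) 0 = c ^ α 0 from rfl]
  · ring
  · intro j _
    rw [hlast, mul_zero, zero_mul]

/-- The Vandermonde determinant is the alternant of the empty diagram. -/
theorem vandermonde_eq_alternant {m : ℕ} (x : Fin m → ℝ) :
    (Matrix.vandermonde x).det = alternant x fun j => (j : ℕ) := rfl

/-- The case of `alternant_branching` in which every exponent range is a single point. -/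
theorem det_vandermonde_castSucc {m : ℕ} (x : Fin (m + 1) → ℝ) :
    (Matrix.vandermonde x).det = (-1) ^ m * (∏ i : Fin m, (x i.castSucc - x (Fin.last m))) *
      (Matrix.vandermonde fun i : Fin m => x i.castSucc).det := by
  rw [vandermonde_eq_alternant, alternant_branching x fun j => by simp]
  have h : (Fintype.piFinset fun j : Fin m =>
      Finset.Ico ((j.castSucc : Fin (m + 1)) : ℕ) ((j.succ : Fin (m + 1)) : ℕ)) =
      {fun j : Fin m => (j : ℕ)} := by
    ext b
    rw [Fintype.mem_piFinset, Finset.mem_singleton, funext_iff]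
    refine forall_congr' fun j => ?_
    rw [Finset.mem_Ico, Fin.val_castSucc, Fin.val_succ]
    omega
  have h' : ∏ j : Fin m, x (Fin.last m) ^ ((j.succ : Fin (m + 1)) - 1 - (j : ℕ) : ℕ) = 1 :=
    Finset.prod_eq_one fun j _ => by
      rw [Fin.val_succ, Nat.add_sub_cancel, Nat.sub_self, pow_zero]
  rw [h, Finset.sum_singleton, h', ← vandermonde_eq_alternant, Fin.val_zero, pow_zero, mul_one,
    one_mul]

theorem schur_zero {lam : YoungDiagram} (hlam : ∀ c ∈ lam, c.1 < 0) (x : Fin 0 → ℝ) :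
    schur lam x = 1 := by
  have hno : ∀ c, c ∉ lam := fun c hc => absurd (hlam c hc) (Nat.not_lt_zero _)
  rw [schur_eq_sum]
  have : Unique (SSYT lam 0) :=
    { default := ⟨SemistandardYoungTableau.highestWeight lam, fun c hc => absurd hc (hno c)⟩
      uniq := fun T => by
        apply Subtype.ext
        apply SemistandardYoungTableau.ext
        intro i j
        rw [T.1.zeros (hno _), SemistandardYoungTableau.zeros _ (hno _)] }
  rw [Fintype.sum_unique]
  simp

/-- Cauchy's bialternant formula; the exponents are the points of `lam` in increasing order. -/
theorem vandermonde_mul_schur {m : ℕ} {lam : YoungDiagram} (hlam : ∀ c ∈ lam, c.1 < m)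
    (x : Fin m → ℝ) :
    (Matrix.vandermonde x).det * schur lam x =
      alternant x fun j => lam.rowLen (m - 1 - j) + j := by
  induction m generalizing lam with
  | zero =>
    rw [schur_zero hlam, alternant, Matrix.det_fin_zero, Matrix.det_fin_zero, mul_one]
  | succ m ih =>
    have hanti := fun i j h => lam.rowLen_anti i j h
    rw [alternant_branching x, det_vandermonde_castSucc, schur_branching hlam, Finset.mul_sum,
      Finset.mul_sum]
    · refine Finset.sum_bij' (fun b _ j => b j.rev + j)
        (fun b _ i => b i.rev - (i.rev : ℕ)) ?_ ?_ ?_ ?_ ?_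
      · intro b hb
        rw [Fintype.mem_piFinset] at hb ⊢
        intro j
        have h := Finset.mem_Icc.1 (hb j.rev)
        rw [Finset.mem_Ico]
        simp only [Fin.val_castSucc, Fin.val_succ, Fin.val_rev] at h ⊢
        have e1 : m - (j + 1) + 1 = m + 1 - 1 - j := by have := j.2; omega
        have e2 : m - ((j : ℕ) + 1) = m + 1 - 1 - (j + 1) := by omega
        rw [e1, e2] at h
        omega
      · intro b hb
        rw [Fintype.mem_piFinset] at hb ⊢
        intro i
        have h := Finset.mem_Ico.1 (hb i.rev)
        rw [Finset.mem_Icc]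
        simp only [Fin.val_castSucc, Fin.val_succ, Fin.val_rev] at h ⊢
        have e1 : m + 1 - 1 - (m - (i + 1)) = (i : ℕ) + 1 := by have := i.2; omega
        have e2 : m + 1 - 1 - (m - (i + 1) + 1) = (i : ℕ) := by have := i.2; omega
        rw [e1, e2] at h
        omega
      · intro b _
        funext i
        simp
      · intro b hb
        rw [Fintype.mem_piFinset] at hb
        funext j
        have h := Finset.mem_Ico.1 (hb j)
        simp only [Fin.val_castSucc, Fin.rev_rev] at h ⊢
        omega
      · intro b hb
        have hb' := fun i => Finset.mem_Icc.1 (Fintype.mem_piFinset.1 hb i)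
        have hbanti : Antitone b := by
          intro i j hij
          rcases hij.eq_or_lt with rfl | h
          · exact le_rfl
          · exact (hb' j).2.trans ((lam.rowLen_anti _ _ (Nat.succ_le_of_lt h)).trans (hb' i).1)
        have h1 := ih (lam := ofRows b) ofRows_fst_lt (fun i => x i.castSucc)
        have h2 : (fun j : Fin m => (ofRows b).rowLen (m - 1 - j) + j) =
            fun j : Fin m => b j.rev + j := by
          funext j
          rw [← rowLen_ofRows hbanti j.rev, Fin.val_rev, Nat.sub_sub, add_comm 1]
        have h3 : ∏ j : Fin m, x (Fin.last m) ^
              (lam.rowLen (m + 1 - 1 - j.succ) + j.succ - 1 - (b j.rev + j)) =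
            x (Fin.last m) ^ ∑ i : Fin m, (lam.rowLen i - b i) := by
          rw [Finset.prod_pow_eq_pow_sum]
          congr 1
          rw [← Equiv.sum_comp Fin.revPerm]
          refine Finset.sum_congr rfl fun j _ => ?_
          rw [Fin.revPerm_apply, Fin.rev_rev, Fin.val_succ, Fin.val_rev,
            show m + 1 - 1 - (m - ((j : ℕ) + 1) + 1) = j by have := j.2; omega]
          omega
        rw [h2] at h1
        rw [h3, ← h1, pow_add, Fin.val_zero, Nat.sub_zero, add_zero, Nat.add_sub_cancel]
        ring
    · intro j
      have := hanti (m + 1 - 1 - j.succ) (m + 1 - 1 - j.castSucc) (by simp; omega)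
      simp only [Fin.val_castSucc, Fin.val_succ] at this ⊢
      omega

end Bialternant

/-! ### The `q`-dimension as a principal specialization -/

section QDim

variable {mu : YoungDiagram} {m : ℕ}

/-- The number of cells of `T` with entry `j`, for any natural number `j`. -/
def cellCount (T : SSYT mu m) (j : ℕ) : ℕ :=
  (mu.cells.filter (fun c => T.1 c.1 c.2 = j)).card

theorem sum_range_cellCount (T : SSYT mu m) (i : ℕ) :
    ∑ j ∈ Finset.range i, cellCount T j = (mu.cells.filter (fun c => T.1 c.1 c.2 < i)).card := by
  rw [Finset.card_eq_sum_card_fiberwise (f := fun c : ℕ × ℕ => T.1 c.1 c.2) (t := Finset.range i)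
    (fun c hc => Finset.mem_coe.2 (Finset.mem_range.2 (Finset.mem_filter.1 hc).2))]
  refine Finset.sum_congr rfl fun j hj => ?_
  rw [cellCount, Finset.filter_filter]
  congr 1
  refine Finset.filter_congr fun c _ => ⟨fun h => ⟨?_, h⟩, fun h => h.2⟩
  exact h.trans_lt (Finset.mem_range.1 hj)

theorem sum_range_rowLen (mu : YoungDiagram) (i : ℕ) :
    ∑ j ∈ Finset.range i, mu.rowLen j = (mu.cells.filter (fun c => c.1 < i)).card := by
  rw [Finset.card_eq_sum_card_fiberwise (f := Prod.fst) (t := Finset.range i)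
    (fun c hc => Finset.mem_coe.2 (Finset.mem_range.2 (Finset.mem_filter.1 hc).2))]
  refine Finset.sum_congr rfl fun j hj => ?_
  rw [YoungDiagram.rowLen_eq_card, YoungDiagram.row, Finset.filter_filter]
  congr 1
  refine Finset.filter_congr fun c _ => ⟨fun h => ⟨?_, h⟩, fun h => h.2⟩
  rw [h]
  exact Finset.mem_range.1 hj

/-- The weights of a representation are dominated by the highest weight. -/
theorem sum_cellCount_le (T : SSYT mu m) (i : ℕ) :
    ∑ j ∈ Finset.range i, cellCount T j ≤ ∑ j ∈ Finset.range i, mu.rowLen j := by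
  rw [sum_range_cellCount, sum_range_rowLen]
  refine Finset.card_le_card fun c hc => ?_
  rw [Finset.mem_filter] at hc ⊢
  exact ⟨hc.1, (le_entry T.1 ((YoungDiagram.mem_cells _).1 hc.1)).trans_lt hc.2⟩

theorem sum_cellCount_eq (hmu : ∀ c ∈ mu, c.1 < m) (T : SSYT mu m) :
    ∑ j ∈ Finset.range m, cellCount T j = ∑ j ∈ Finset.range m, mu.rowLen j := by
  rw [sum_range_cellCount, sum_range_rowLen, Finset.filter_true_of_mem, Finset.filter_true_of_mem]
  · exact fun c hc => hmu c ((YoungDiagram.mem_cells _).1 hc)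
  · exact fun c hc => T.2 c ((YoungDiagram.mem_cells _).1 hc)

/-- The coefficients of `μ - wt T` in the simple roots; the truncated subtraction is harmless by
`sum_cellCount_le`. -/
def rootCoeff (T : SSYT mu m) (i : Fin (m - 1)) : ℕ :=
  ∑ j ∈ Finset.range (i + 1), mu.rowLen j - ∑ j ∈ Finset.range (i + 1), cellCount T j

/-- The family `u` on the simple roots, shifted by one and extended by zero. -/
def shiftExtend (u : Fin (m - 1) → ℕ) : ℕ → ℤ
  | 0 => 0
  | i + 1 => if h : i < m - 1 then u ⟨i, h⟩ else 0

theorem shiftExtend_succ (u : Fin (m - 1) → ℕ) (i : Fin (m - 1)) :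
    shiftExtend u (i + 1) = u i := dif_pos i.2

theorem shiftExtend_self (u : Fin (m - 1) → ℕ) : shiftExtend u m = 0 := by
  cases m with
  | zero => rfl
  | succ m => exact dif_neg (lt_irrefl m)

theorem sum_mul_simpleRoot (u : Fin (m - 1) → ℕ) (j : Fin m) :
    ∑ i, (u i : ℤ) * simpleRoot m i j = shiftExtend u (j + 1) - shiftExtend u j := by
  have h1 : ∀ i : Fin (m - 1), (u i : ℤ) * simpleRoot m i j =
      (if (i : ℕ) = j then (u i : ℤ) else 0) - if (i : ℕ) + 1 = j then (u i : ℤ) else 0 := by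
    intro i
    rw [simpleRoot]
    split_ifs <;> omega
  rw [Finset.sum_congr rfl fun i _ => h1 i, Finset.sum_sub_distrib]
  congr 1
  · rw [shiftExtend]
    split_ifs with h
    · rw [Finset.sum_eq_single ⟨j, h⟩]
      · exact if_pos rfl
      · intro i _ hi
        exact if_neg fun h' => hi (Fin.ext h')
      · exact fun h' => absurd (Finset.mem_univ _) h'
    · exact Finset.sum_eq_zero fun i _ => if_neg (by omega)
  · obtain ⟨j, hj⟩ := j
    cases j with
    | zero => exact Finset.sum_eq_zero fun i _ => if_neg (by simp)
    | succ j =>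
      have h : j < m - 1 := by omega
      change _ = shiftExtend u (j + 1)
      rw [shiftExtend, dif_pos h, Finset.sum_eq_single ⟨j, h⟩]
      · exact if_pos rfl
      · intro i _ hi
        exact if_neg fun h' => hi (Fin.ext (by simpa using h'))
      · exact fun h' => absurd (Finset.mem_univ _) h'

theorem shiftExtend_rootCoeff (hmu : ∀ c ∈ mu, c.1 < m) (T : SSYT mu m) {i : ℕ} (hi : i ≤ m) :
    shiftExtend (rootCoeff T) i =
      ∑ j ∈ Finset.range i, (mu.rowLen j : ℤ) - ∑ j ∈ Finset.range i, (cellCount T j : ℤ) := by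
  rcases hi.eq_or_lt with rfl | hi
  · rw [shiftExtend_self, ← Nat.cast_sum, ← Nat.cast_sum, sum_cellCount_eq hmu, sub_self]
  · cases i with
    | zero => simp [shiftExtend]
    | succ i =>
      rw [shiftExtend, dif_pos (by omega), rootCoeff, Nat.cast_sub (sum_cellCount_le T _)]
      push_cast
      rfl

/-- `T` has weight `μ - ∑ u_i α_i` exactly when `u` is its family of root coefficients. -/
theorem content_eq_iff (hmu : ∀ c ∈ mu, c.1 < m) (T : SSYT mu m) (u : Fin (m - 1) → ℕ) :
    (∀ j : Fin m, (content T j : ℤ) =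
      mu.rowLen j - ∑ i, (u i : ℤ) * simpleRoot m i j) ↔ rootCoeff T = u := by
  simp only [sum_mul_simpleRoot]
  constructor
  · intro h
    funext i
    have hm : (i : ℕ) + 1 ≤ m := by have := i.2; omega
    have h1 : ∑ j ∈ Finset.range (i + 1), (cellCount T j : ℤ) =
        ∑ j ∈ Finset.range (i + 1), ((mu.rowLen j : ℤ) -
          (shiftExtend u (j + 1) - shiftExtend u j)) :=
      Finset.sum_congr rfl fun j hj =>
        h ⟨j, (Finset.mem_range.1 hj).trans_le hm⟩
    rw [Finset.sum_sub_distrib, Finset.sum_range_sub, shiftExtend_succ] at h1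
    have h2 := shiftExtend_rootCoeff hmu T hm
    rw [shiftExtend_succ, h1, shiftExtend] at h2
    have : (rootCoeff T i : ℤ) = u i := by linarith
    exact_mod_cast this
  · rintro rfl j
    rw [shiftExtend_rootCoeff hmu T j.2, shiftExtend_rootCoeff hmu T j.2.le,
      Finset.sum_range_succ, Finset.sum_range_succ]
    change (cellCount T j : ℤ) = _
    ring

/-- The weight multiplicities count the tableaux of the given content. -/
theorem weightMult_eq (mu : YoungDiagram) (nu : Fin m → ℤ) :
    weightMult mu nu =
      ∑ T : SSYT mu m, if ∀ j, (content T j : ℤ) = nu j then 1 else 0 := by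
  rw [weightMult]
  split_ifs with h
  · rw [schurPoly, MvPolynomial.coeff_sum]
    refine Finset.sum_congr rfl fun T _ => ?_
    have h1 : (∏ i : Fin m, MvPolynomial.X i ^ content T i : MvPolynomial (Fin m) ℤ) =
        MvPolynomial.monomial (Finsupp.equivFunOnFinite.symm (content T)) 1 := by
      rw [MvPolynomial.monomial_eq, MvPolynomial.C_1, one_mul, Finsupp.prod_fintype]
      · rfl
      · exact fun i => pow_zero _
    rw [h1, MvPolynomial.coeff_monomial]
    refine if_congr ?_ rfl rfl
    rw [Equiv.apply_eq_iff_eq, funext_iff]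
    refine forall_congr' fun j => ?_
    have := h j
    omega
  · push Not at h
    obtain ⟨j, hj⟩ := h
    refine (Finset.sum_eq_zero fun T _ => if_neg fun h' => ?_).symm
    have := h' j
    omega

/-- The principal gradation: `∑ i ν_i` increases by one when a simple root is subtracted from `ν`. -/
theorem rowNorm_add_sum_rootCoeff (hmu : ∀ c ∈ mu, c.1 < m) (T : SSYT mu m) :
    rowNorm m mu + ∑ i, rootCoeff T i = ∑ j : Fin m, (j : ℕ) * content T j := by
  set g := shiftExtend (rootCoeff T) with hg
  have h1 : ∀ i, ∑ j ∈ Finset.range i, (j : ℤ) * (g (j + 1) - g j) =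
      i * g i - ∑ j ∈ Finset.range i, g (j + 1) := by
    intro i
    induction i with
    | zero => simp
    | succ i ih =>
      rw [Finset.sum_range_succ, ih, Finset.sum_range_succ]
      push_cast
      ring
  have h2 : ∑ j ∈ Finset.range m, g (j + 1) = ∑ i, (rootCoeff T i : ℤ) := by
    rcases Nat.eq_zero_or_pos m with rfl | hm
    · simp
    · have hlast : g (m - 1 + 1) = 0 := by
        rw [Nat.sub_add_cancel hm]
        exact shiftExtend_self _
      have : Finset.range m = Finset.range (m - 1 + 1) := by rw [Nat.sub_add_cancel hm]
      rw [this, Finset.sum_range_succ, hlast, add_zero, Finset.sum_range]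
      exact Finset.sum_congr rfl fun i _ => shiftExtend_succ _ i
  have h3 := (content_eq_iff hmu T (rootCoeff T)).2 rfl
  simp only [sum_mul_simpleRoot] at h3
  have h4 := h1 m
  rw [show g m = 0 from shiftExtend_self _, mul_zero, zero_sub, h2, Finset.sum_range] at h4
  have h5 : (∑ j : Fin m, (j : ℕ) * content T j : ℤ) =
      ∑ j : Fin m, (j : ℕ) * (mu.rowLen j : ℤ) -
        ∑ j : Fin m, ((j : ℕ) : ℤ) * (g (j + 1) - g j) := by
    rw [← Finset.sum_sub_distrib]
    refine Finset.sum_congr rfl fun j _ => ?_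
    rw [h3 j]
    ring
  rw [h4, sub_neg_eq_add] at h5
  rw [rowNorm]
  exact_mod_cast h5.symm

/-- The `q`-dimension is the principal specialization of the character. -/
theorem pow_rowNorm_mul_qDim (hmu : ∀ c ∈ mu, c.1 < m) (q : ℝ) :
    q ^ rowNorm m mu * qDim m mu q = schur mu (fun i : Fin m => q ^ (i : ℕ)) := by
  have h1 : (fun u : Fin (m - 1) → ℕ => q ^ (∑ i, u i) * (weightMult mu (fun j : Fin m =>
      (mu.rowLen j : ℤ) - ∑ i, (u i : ℤ) * simpleRoot m i j) : ℝ)) =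
      fun u => ∑ T : SSYT mu m, if rootCoeff T = u then q ^ (∑ i, rootCoeff T i) else 0 := by
    funext u
    rw [weightMult_eq]
    push_cast
    rw [Finset.mul_sum]
    refine Finset.sum_congr rfl fun T _ => ?_
    rw [mul_ite, mul_one, mul_zero]
    have := content_eq_iff hmu T u
    by_cases h : rootCoeff T = u
    · rw [if_pos (this.2 h), if_pos h, h]
    · rw [if_neg fun h' => h (this.1 h'), if_neg h]
  have h2 : qDim m mu q = ∑ T : SSYT mu m, q ^ (∑ i, rootCoeff T i) := by
    rw [qDim, h1, finsum_eq_sum_of_support_subset (s := Finset.univ.image fun T : SSYT mu m =>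
      rootCoeff T), Finset.sum_comm]
    · refine Finset.sum_congr rfl fun T _ => ?_
      rw [Finset.sum_ite_eq, if_pos (Finset.mem_image_of_mem _ (Finset.mem_univ T))]
    · intro u hu
      obtain ⟨T, -, hT⟩ := Finset.exists_ne_zero_of_sum_ne_zero hu
      refine Finset.mem_coe.2 (Finset.mem_image.2 ⟨T, Finset.mem_univ _, ?_⟩)
      by_contra h
      exact hT (if_neg h)
  rw [h2, schur_eq_sum, Finset.mul_sum]
  refine Finset.sum_congr rfl fun T _ => ?_
  rw [← pow_add, rowNorm_add_sum_rootCoeff hmu, ← Finset.prod_pow_eq_pow_sum]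
  exact Finset.prod_congr rfl fun i _ => pow_mul _ _ _

end QDim

/-! ### Vandermonde products over finite sets of exponents -/

section VandermondeProduct

variable {q : ℝ}

/-- The absolute value of the Vandermonde product of the numbers `q ^ a`, `a ∈ S`. -/
noncomputable def vProd (q : ℝ) (S : Finset ℕ) : ℝ :=
  ∏ a ∈ S, ∏ b ∈ S.filter (a < ·), |q ^ b - q ^ a|

theorem abs_pow_sub_pow_pos (hq0 : 0 < q) (hq1 : q ≠ 1) {a b : ℕ} (h : b ≠ a) :
    0 < |q ^ b - q ^ a| :=
  abs_pos.2 (sub_ne_zero.2 fun h' => h (pow_right_injective₀ hq0 hq1 h'))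

theorem vProd_pos (hq0 : 0 < q) (hq1 : q ≠ 1) (S : Finset ℕ) : 0 < vProd q S :=
  Finset.prod_pos fun _ _ => Finset.prod_pos fun _ hb =>
    abs_pow_sub_pow_pos hq0 hq1 (Finset.mem_filter.1 hb).2.ne'

theorem abs_det_vandermonde (q : ℝ) {m : ℕ} {f : Fin m → ℕ} (hf : StrictMono f) :
    |(Matrix.vandermonde fun i => q ^ f i).det| = vProd q (Finset.univ.image f) := by
  rw [Matrix.det_vandermonde, Finset.abs_prod, vProd, Finset.prod_image hf.injective.injOn]
  refine Finset.prod_congr rfl fun i _ => ?_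
  have h : (Finset.univ.image f).filter (f i < ·) = (Finset.Ioi i).image f := by
    ext b
    simp only [Finset.mem_filter, Finset.mem_image, Finset.mem_univ, true_and, Finset.mem_Ioi]
    constructor
    · rintro ⟨⟨j, rfl⟩, h⟩
      exact ⟨j, hf.lt_iff_lt.1 h, rfl⟩
    · rintro ⟨j, h, rfl⟩
      exact ⟨⟨j, rfl⟩, hf h⟩
  rw [h, Finset.prod_image hf.injective.injOn, Finset.abs_prod]

theorem vProd_insert_max (q : ℝ) {S : Finset ℕ} {m : ℕ} (h : ∀ a ∈ S, a < m) :
    vProd q (insert m S) = vProd q S * ∏ a ∈ S, |q ^ m - q ^ a| := by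
  have hm : m ∉ S := fun h' => lt_irrefl _ (h m h')
  rw [vProd, Finset.prod_insert hm, vProd, ← Finset.prod_mul_distrib]
  have h1 : (insert m S).filter (m < ·) = ∅ := by
    refine Finset.filter_eq_empty_iff.2 fun b hb => ?_
    rcases Finset.mem_insert.1 hb with rfl | hb
    · exact lt_irrefl _
    · exact (h b hb).not_gt
  rw [h1, Finset.prod_empty, one_mul]
  refine Finset.prod_congr rfl fun a ha => ?_
  rw [Finset.filter_insert, if_pos (h a ha), Finset.prod_insert, mul_comm]
  exact fun h' => hm (Finset.mem_filter.1 h').1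

theorem prod_abs_pow_sub_pow (hq0 : 0 < q) (m : ℕ) :
    ∏ a ∈ Finset.range m, |q ^ m - q ^ a| = q ^ m.choose 2 * |qPoch q q m| := by
  rw [qPoch, Finset.abs_prod, ← Finset.prod_range_reflect (fun i => |1 - q * q ^ i|),
    Nat.choose_two_right, ← Finset.sum_range_id, ← Finset.prod_pow_eq_pow_sum,
    ← Finset.prod_mul_distrib]
  refine Finset.prod_congr rfl fun a ha => ?_
  have h := Finset.mem_range.1 ha
  rw [← abs_of_pos (pow_pos hq0 a), ← abs_mul, abs_of_pos (pow_pos hq0 a), abs_sub_comm, mul_sub,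
    mul_one, ← pow_succ', ← pow_add]
  congr 3
  omega

theorem vProd_range_add (hq0 : 0 < q) (m l : ℕ) :
    vProd q (Finset.range (m + l)) = vProd q (Finset.range m) *
      ∏ i ∈ Finset.range l, q ^ (m + i).choose 2 * |qPoch q q (m + i)| := by
  induction l with
  | zero => simp
  | succ l ih =>
    rw [← add_assoc, Finset.range_add_one, vProd_insert_max q fun a => Finset.mem_range.1, ih,
      prod_abs_pow_sub_pow hq0, Finset.prod_range_succ, mul_assoc]

theorem vProd_range (hq0 : 0 < q) (m : ℕ) :
    vProd q (Finset.range m) = ∏ i ∈ Finset.range m, q ^ i.choose 2 * |qPoch q q i| := by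
  have h := vProd_range_add hq0 0 m
  simpa [vProd] using h

theorem prod_prod_filter_comm (S T : Finset ℕ) (g : ℕ → ℕ → ℝ) :
    ∏ a ∈ T, ∏ b ∈ S.filter (a < ·), g a b = ∏ b ∈ S, ∏ a ∈ T.filter (· < b), g a b := by
  simp only [Finset.prod_filter]
  exact Finset.prod_comm

theorem prod_filter_lt_mul_prod_filter_gt (S : Finset ℕ) (a : ℕ) (g : ℕ → ℝ) :
    (∏ b ∈ S.filter (a < ·), g b) * ∏ b ∈ S.filter (· < a), g b = ∏ b ∈ S.erase a, g b := by
  rw [← Finset.prod_union]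
  · refine Finset.prod_congr ?_ fun _ _ => rfl
    ext b
    simp only [Finset.mem_union, Finset.mem_filter, Finset.mem_erase]
    constructor
    · rintro (⟨h1, h2⟩ | ⟨h1, h2⟩)
      · exact ⟨h2.ne', h1⟩
      · exact ⟨h2.ne, h1⟩
    · rintro ⟨h1, h2⟩
      rcases lt_or_gt_of_ne h1 with h | h
      · exact Or.inr ⟨h2, h⟩
      · exact Or.inl ⟨h2, h⟩
  · rw [Finset.disjoint_left]
    intro b h1 h2
    exact lt_asymm (Finset.mem_filter.1 h1).2 (Finset.mem_filter.1 h2).2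

theorem vProd_union (q : ℝ) {S T : Finset ℕ} (h : Disjoint S T) :
    vProd q (S ∪ T) = vProd q S * vProd q T * ∏ a ∈ S, ∏ b ∈ T, |q ^ b - q ^ a| := by
  have hsplit : ∀ a, ∏ b ∈ (S ∪ T).filter (a < ·), |q ^ b - q ^ a| =
      (∏ b ∈ S.filter (a < ·), |q ^ b - q ^ a|) * ∏ b ∈ T.filter (a < ·), |q ^ b - q ^ a| := by
    intro a
    rw [Finset.filter_union, Finset.prod_union (Finset.disjoint_filter_filter h)]
  have hcross : ∏ a ∈ S, ∏ b ∈ T, |q ^ b - q ^ a| =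
      (∏ a ∈ S, ∏ b ∈ T.filter (a < ·), |q ^ b - q ^ a|) *
        ∏ a ∈ T, ∏ b ∈ S.filter (a < ·), |q ^ b - q ^ a| := by
    rw [prod_prod_filter_comm S T, ← Finset.prod_mul_distrib]
    refine Finset.prod_congr rfl fun a ha => ?_
    have h1 : T = T.erase a := (Finset.erase_eq_of_notMem (Finset.disjoint_left.1 h ha)).symm
    nth_rewrite 1 [h1]
    rw [← prod_filter_lt_mul_prod_filter_gt]
    congr 1
    exact Finset.prod_congr rfl fun b _ => abs_sub_comm _ _
  rw [vProd, Finset.prod_union h]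
  simp only [hsplit, Finset.prod_mul_distrib]
  rw [hcross, vProd, vProd]
  ring

theorem prod_prod_erase (q : ℝ) (S : Finset ℕ) :
    ∏ a ∈ S, ∏ b ∈ S.erase a, |q ^ b - q ^ a| = vProd q S ^ 2 := by
  rw [Finset.prod_congr rfl fun a _ => (prod_filter_lt_mul_prod_filter_gt S a _).symm,
    Finset.prod_mul_distrib, pow_two]
  congr 1
  rw [vProd, prod_prod_filter_comm]
  exact Finset.prod_congr rfl fun a _ => Finset.prod_congr rfl fun b _ => abs_sub_comm _ _

/-- The Vandermonde product of a complement, in terms of the original set. -/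
theorem vProd_sdiff_mul (q : ℝ) {S U : Finset ℕ} (h : S ⊆ U) :
    vProd q (U \ S) * ∏ a ∈ S, ∏ b ∈ U.erase a, |q ^ b - q ^ a| = vProd q U * vProd q S := by
  have h1 : ∀ a ∈ S, ∏ b ∈ U.erase a, |q ^ b - q ^ a| =
      (∏ b ∈ S.erase a, |q ^ b - q ^ a|) * ∏ b ∈ U \ S, |q ^ b - q ^ a| := by
    intro a ha
    rw [← Finset.prod_union]
    · refine Finset.prod_congr ?_ fun _ _ => rfl
      ext b
      simp only [Finset.mem_erase, Finset.mem_union, Finset.mem_sdiff]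
      constructor
      · rintro ⟨h1, h2⟩
        by_cases hb : b ∈ S
        · exact Or.inl ⟨h1, hb⟩
        · exact Or.inr ⟨h2, hb⟩
      · rintro (⟨h1, h2⟩ | ⟨h1, h2⟩)
        · exact ⟨h1, h h2⟩
        · exact ⟨fun h' => h2 (h' ▸ ha), h1⟩
    · rw [Finset.disjoint_left]
      intro b h1 h2
      exact (Finset.mem_sdiff.1 h2).2 (Finset.mem_erase.1 h1).2
  have h2 := vProd_union q (Finset.disjoint_sdiff (s := S) (t := U))
  rw [Finset.union_sdiff_of_subset h] at h2
  rw [Finset.prod_congr rfl h1, Finset.prod_mul_distrib, prod_prod_erase, h2]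
  ring

theorem prod_range_erase (hq0 : 0 < q) (a r : ℕ) :
    ∏ b ∈ (Finset.range (a + r + 1)).erase a, |q ^ b - q ^ a| =
      q ^ (a.choose 2 + a * r) * (|qPoch q q a| * |qPoch q q r|) := by
  have h1 : (Finset.range (a + r + 1)).filter (· < a) = Finset.range a := by
    ext b
    simp only [Finset.mem_filter, Finset.mem_range]
    omega
  have h2 : (Finset.range (a + r + 1)).filter (a < ·) =
      (Finset.range r).image (fun i => a + (i + 1)) := by
    ext b
    simp only [Finset.mem_filter, Finset.mem_range, Finset.mem_image]
    constructor
    · exact fun h => ⟨b - a - 1, by omega, by omega⟩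
    · rintro ⟨i, h, rfl⟩
      omega
  have h3 : ∏ i ∈ Finset.range r, |q ^ (a + (i + 1)) - q ^ a| = q ^ (a * r) * |qPoch q q r| := by
    rw [qPoch, Finset.abs_prod, pow_mul, show (q ^ a) ^ r = ∏ _i ∈ Finset.range r, q ^ a by simp,
      ← Finset.prod_mul_distrib]
    refine Finset.prod_congr rfl fun i _ => ?_
    rw [← abs_of_pos (pow_pos hq0 a), ← abs_mul, abs_of_pos (pow_pos hq0 a), abs_sub_comm]
    congr 1
    ring
  rw [← prod_filter_lt_mul_prod_filter_gt, h1, h2, Finset.prod_image (fun i _ j _ h => by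
    simpa using h), h3, Finset.prod_congr rfl fun b _ => abs_sub_comm (q ^ b) (q ^ a),
    prod_abs_pow_sub_pow hq0, pow_add]
  ring

/-- Each exponent lies in `S.card - 1` pairs, and `q ^ (-a) - q ^ (-b)` differs from `q ^ b - q ^ a` by
the factor `q ^ (-a - b)`. -/
theorem vProd_inv (hq0 : 0 < q) (S : Finset ℕ) :
    vProd q⁻¹ S = vProd q S * ∏ a ∈ S, q ^ (-(((S.card : ℤ) - 1) * a)) := by
  have hq := hq0.ne'
  induction S using Finset.induction_on_max with
  | empty => simp [vProd]
  | insert m S h ih =>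
    have hm : m ∉ S := fun h' => lt_irrefl _ (h m h')
    have h1 : ∏ a ∈ S, |q⁻¹ ^ m - q⁻¹ ^ a| =
        q ^ (-((S.card : ℤ) * m)) * ∏ a ∈ S, q ^ (-(a : ℤ)) * |q ^ m - q ^ a| := by
      rw [show q ^ (-((S.card : ℤ) * m)) = ∏ _a ∈ S, q ^ (-(m : ℤ)) by
        rw [Finset.prod_const, ← zpow_natCast, ← zpow_mul]; congr 1; ring,
        ← Finset.prod_mul_distrib]
      refine Finset.prod_congr rfl fun a _ => ?_
      rw [← mul_assoc, ← abs_of_pos (mul_pos (zpow_pos hq0 (-(m : ℤ))) (zpow_pos hq0 (-(a : ℤ)))),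
        ← abs_mul, abs_sub_comm, zpow_neg, zpow_neg, zpow_natCast, zpow_natCast, inv_pow, inv_pow]
      congr 1
      field_simp
    have h2 : ∏ a ∈ S, q ^ (-((S.card : ℤ) * a)) =
        (∏ a ∈ S, q ^ (-(((S.card : ℤ) - 1) * a))) * ∏ a ∈ S, q ^ (-(a : ℤ)) := by
      rw [← Finset.prod_mul_distrib]
      refine Finset.prod_congr rfl fun a _ => ?_
      rw [← zpow_add₀ hq]; congr 1; ring
    rw [vProd_insert_max _ h, vProd_insert_max _ h, ih, Finset.prod_insert hm,
      Finset.card_insert_of_notMem hm, h1, Finset.prod_mul_distrib]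
    push_cast
    rw [add_sub_cancel_right, h2]
    ring

end VandermondeProduct

/-! ### Point configurations of diagrams -/

section Points

variable {n k : ℕ} {lam : YoungDiagram}

/-- The set of points `a_i = λ_i + n - i` of a diagram. -/
def pointSet (n : ℕ) (lam : YoungDiagram) : Finset ℕ := Finset.univ.image (point n lam)

theorem point_strictAnti (n : ℕ) (lam : YoungDiagram) : StrictAnti (point n lam) := by
  intro i j hij
  have h := lam.rowLen_anti i j (le_of_lt hij)
  have := j.2
  have : (i : ℕ) < j := hij
  simp only [point]
  omega

theorem strictMono_point_rev (n : ℕ) (lam : YoungDiagram) :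
    StrictMono fun i : Fin n => point n lam i.rev := fun _ _ h =>
  point_strictAnti n lam (Fin.rev_lt_rev.2 h)

theorem image_point_rev (n : ℕ) (lam : YoungDiagram) :
    (Finset.univ.image fun i : Fin n => point n lam i.rev) = pointSet n lam := by
  ext a
  simp only [pointSet, Finset.mem_image, Finset.mem_univ, true_and]
  exact ⟨fun ⟨i, h⟩ => ⟨i.rev, h⟩, fun ⟨i, h⟩ => ⟨i.rev, by rw [Fin.rev_rev, h]⟩⟩

theorem card_pointSet (n : ℕ) (lam : YoungDiagram) : (pointSet n lam).card = n := by
  rw [pointSet, Finset.card_image_of_injective _ (point_strictAnti n lam).injective,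
    Finset.card_univ, Fintype.card_fin]

theorem rowLen_le_of_mem_box (h : lam ∈ boxDiagrams n k) (i : ℕ) : lam.rowLen i ≤ k := by
  by_contra hlt
  exact lt_irrefl _ (h (i, k) (YoungDiagram.mem_iff_lt_rowLen.2 (not_le.1 hlt))).2

theorem pointSet_subset (h : lam ∈ boxDiagrams n k) : pointSet n lam ⊆ Finset.range (n + k) := by
  intro a ha
  obtain ⟨i, -, rfl⟩ := Finset.mem_image.1 ha
  have := rowLen_le_of_mem_box h i
  have := i.2
  rw [Finset.mem_range, point]
  omega

theorem mem_complConj {i j : ℕ} :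
    (j, i) ∈ complConj n k lam ↔ (i < n ∧ j < k) ∧ (n - 1 - i, k - 1 - j) ∉ lam := by
  rw [complConj, YoungDiagram.mem_transpose, ← YoungDiagram.mem_cells, boxComplement,
    Finset.mem_filter, Prod.swap_prod_mk, Finset.mem_product, Finset.mem_range, Finset.mem_range]

theorem complConj_mem_box : complConj n k lam ∈ boxDiagrams k n := by
  rintro ⟨j, i⟩ hc
  exact (mem_complConj.1 hc).1.symm

theorem lt_rowLen_complConj_iff {i j : ℕ} (hi : i < n) (hj : j < k) :
    n - 1 - i < (complConj n k lam).rowLen j ↔ lam.rowLen i ≤ k - 1 - j := by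
  rw [← YoungDiagram.mem_iff_lt_rowLen, mem_complConj, ← not_lt,
    ← YoungDiagram.mem_iff_lt_rowLen, show n - 1 - (n - 1 - i) = i by omega]
  exact ⟨fun h => h.2, fun h => ⟨⟨by omega, hj⟩, h⟩⟩

/-- The points of the complement conjugate diagram are the holes of the original diagram. -/
theorem pointSet_complConj (h : lam ∈ boxDiagrams n k) :
    pointSet k (complConj n k lam) = Finset.range (n + k) \ pointSet n lam := by
  refine Finset.eq_of_subset_of_card_le (fun b hb => Finset.mem_sdiff.2 ⟨?_, fun ha => ?_⟩) ?_
  · rw [add_comm n k]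
    exact pointSet_subset complConj_mem_box hb
  · obtain ⟨j, -, rfl⟩ := Finset.mem_image.1 hb
    obtain ⟨i, -, hij⟩ := Finset.mem_image.1 ha
    have h1 := lt_rowLen_complConj_iff (lam := lam) i.2 j.2
    simp only [point] at hij
    omega
  · rw [Finset.card_sdiff_of_subset (pointSet_subset h), card_pointSet, card_pointSet,
      Finset.card_range]
    omega

end Points

/-! ### Principal specializations and the character measure -/

section Specialization

variable {q : ℝ}

theorem schur_nonneg (mu : YoungDiagram) {m : ℕ} {x : Fin m → ℝ} (hx : ∀ i, 0 ≤ x i) :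
    0 ≤ schur mu x := by
  rw [schur_eq_sum]
  exact Finset.sum_nonneg fun T _ => Finset.prod_nonneg fun i _ => pow_nonneg (hx i) _

/-- At a geometric progression the alternant is itself a Vandermonde determinant. -/
theorem schur_geometric (hq0 : 0 < q) (hq1 : q ≠ 1) {m : ℕ} {lam : YoungDiagram}
    (hlam : ∀ c ∈ lam, c.1 < m) :
    schur lam (fun i : Fin m => q ^ (i : ℕ)) =
      vProd q (pointSet m lam) / vProd q (Finset.range m) := by
  have h := congrArg abs (vandermonde_mul_schur hlam fun i : Fin m => q ^ (i : ℕ))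
  have h1 : alternant (fun i : Fin m => q ^ (i : ℕ)) (fun j => lam.rowLen (m - 1 - j) + j) =
      (Matrix.vandermonde fun j : Fin m => q ^ point m lam j.rev).det := by
    rw [alternant, ← Matrix.det_transpose]
    congr 1
    ext j i
    rw [Matrix.transpose_apply, Matrix.of_apply, Matrix.vandermonde_apply, point, Fin.val_rev,
      ← pow_mul, ← pow_mul, mul_comm, Nat.sub_sub, add_comm 1]
    congr 3
    have := j.2
    omega
  have h2 : (Finset.univ.image fun i : Fin m => (i : ℕ)) = Finset.range m := by
    ext a
    simp only [Finset.mem_image, Finset.mem_univ, true_and, Finset.mem_range]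
    exact ⟨fun ⟨i, h⟩ => h ▸ i.2, fun h => ⟨⟨a, h⟩, rfl⟩⟩
  rw [abs_mul, abs_of_nonneg (schur_nonneg lam fun i => pow_nonneg hq0.le _), h1,
    abs_det_vandermonde q Fin.val_strictMono, abs_det_vandermonde q (strictMono_point_rev m lam),
    image_point_rev, h2] at h
  rw [eq_div_iff (vProd_pos hq0 hq1 _).ne', mul_comm, h]

/-- The two Vandermonde products of a configuration and of its holes combine to the weight of a
discrete orthogonal polynomial ensemble in the variable `q ^ (-a)`. -/
theorem vProd_mul_vProd_sdiff (hq0 : 0 < q) (hq1 : q ≠ 1) {n K : ℕ} {S : Finset ℕ}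
    (hS : S ⊆ Finset.range (n + K + 1)) (hcard : S.card = n) :
    vProd q S / vProd q (Finset.range n) *
        (vProd q (Finset.range (n + K + 1) \ S) / vProd q (Finset.range (K + 1))) =
      (∏ a ∈ S, weightQ n (K + 1) q a) * vProd q⁻¹ S ^ 2 *
        |∏ l ∈ Finset.range n, (q ^ (((n + K - l).choose 2 : ℤ) - l.choose 2) *
          (qPoch q q (n + K - l) / (qPoch q q l * qPoch q q (n + K))))| := by
  have hq := hq0.ne'
  have hP := fun m => abs_pos.2 (qPoch_self_ne_zero hq0 hq1 m)
  have hD : 0 < ∏ a ∈ S, ∏ b ∈ (Finset.range (n + K + 1)).erase a, |q ^ b - q ^ a| :=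
    Finset.prod_pos fun a _ => Finset.prod_pos fun b hb =>
      abs_pow_sub_pow_pos hq0 hq1 (Finset.mem_erase.1 hb).1
  have hc := vProd_sdiff_mul q hS
  rw [← eq_div_iff hD.ne'] at hc
  have hU : vProd q (Finset.range (n + K + 1)) = vProd q (Finset.range (K + 1)) *
      ∏ l ∈ Finset.range n, q ^ (n + K - l).choose 2 * |qPoch q q (n + K - l)| := by
    rw [show n + K + 1 = K + 1 + n by ring, vProd_range_add hq0, ← Finset.prod_range_reflect]
    congr 1
    refine Finset.prod_congr rfl fun l hl => ?_
    have := Finset.mem_range.1 hl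
    rw [show K + 1 + (n - 1 - l) = n + K - l by omega]
  have hA : |∏ l ∈ Finset.range n, (q ^ (((n + K - l).choose 2 : ℤ) - l.choose 2) *
          (qPoch q q (n + K - l) / (qPoch q q l * qPoch q q (n + K))))| =
      (∏ l ∈ Finset.range n, q ^ (n + K - l).choose 2 * |qPoch q q (n + K - l)|) /
        vProd q (Finset.range n) / |qPoch q q (n + K)| ^ n := by
    rw [vProd_range hq0, show |qPoch q q (n + K)| ^ n =
      ∏ _l ∈ Finset.range n, |qPoch q q (n + K)| by simp, ← Finset.prod_div_distrib,
      ← Finset.prod_div_distrib, Finset.abs_prod]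
    refine Finset.prod_congr rfl fun l _ => ?_
    rw [abs_mul, abs_div, abs_mul, abs_of_pos (zpow_pos hq0 _), zpow_sub₀ hq, zpow_natCast,
      zpow_natCast]
    have := hP l
    have := hP (n + K)
    field_simp
  have hW : (∏ a ∈ S, weightQ n (K + 1) q a) * vProd q⁻¹ S ^ 2 =
      vProd q S ^ 2 * |qPoch q q (n + K)| ^ n /
        ∏ a ∈ S, ∏ b ∈ (Finset.range (n + K + 1)).erase a, |q ^ b - q ^ a| := by
    rw [vProd_inv hq0, mul_pow, ← Finset.prod_pow, mul_left_comm, ← Finset.prod_mul_distrib,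
      mul_div_assoc]
    congr 1
    rw [← hcard, ← Finset.prod_const, ← Finset.prod_div_distrib, hcard]
    refine Finset.prod_congr rfl fun a ha => ?_
    obtain ⟨r, hr⟩ : ∃ r, n + K = a + r :=
      Nat.exists_eq_add_of_le (Nat.lt_succ_iff.1 (Finset.mem_range.1 (hS ha)))
    have hb : qBinom q (n + (K + 1) - 1) a =
        |qPoch q q (a + r)| / (|qPoch q q a| * |qPoch q q r|) := by
      rw [show n + (K + 1) - 1 = a + r by omega, ← abs_of_pos (qBinom_pos hq0 hq1 _ _),
        qBinom_add hq1, abs_div, abs_mul]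
    have he : q ^ ((a.choose 2 : ℤ) + (a : ℤ) * ((n : ℤ) - ((K + 1 : ℕ) : ℤ))) *
        (q ^ (-(((n : ℤ) - 1) * a))) ^ 2 * q ^ (a.choose 2 + a * r) = 1 := by
      simp only [← zpow_natCast, ← zpow_mul, ← zpow_add₀ hq]
      rw [← zpow_zero q]
      congr 1
      have h1 := choose_two_mul_two a
      have h2 : (n : ℤ) + K = a + r := by exact_mod_cast hr
      push_cast
      linear_combination h1 - a * h2
    rw [weightQ, hb, hr, prod_range_erase hq0]
    have := hP a
    have := hP r
    generalize q ^ ((a.choose 2 : ℤ) + (a : ℤ) * ((n : ℤ) - ((K + 1 : ℕ) : ℤ))) = X at *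
    generalize q ^ (-(((n : ℤ) - 1) * a)) = Y at *
    field_simp
    linear_combination |qPoch q q (a + r)| * he
  have h1 := vProd_pos hq0 hq1 (Finset.range n)
  have h2 := vProd_pos hq0 hq1 (Finset.range (K + 1))
  have h3 := hP (n + K)
  rw [hW, hA, hc, hU]
  field_simp

end Specialization

/-! ### The Cauchy–Binet formula -/

section CauchyBinet

theorem sum_filter_image_eq {n : ℕ} {R S : Finset ℕ} (hS : S ∈ Finset.powersetCard n R)
    {e : Fin n → ℕ} (he : Function.Injective e) (himg : Finset.univ.image e = S)
    (F : (Fin n → ℕ) → ℝ) :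
    ∑ f ∈ (Fintype.piFinset fun _ : Fin n => R).filter (fun f => Finset.univ.image f = S), F f =
      ∑ σ : Equiv.Perm (Fin n), F fun l => e (σ l) := by
  obtain ⟨hSR, hcard⟩ := Finset.mem_powersetCard.1 hS
  symm
  refine Finset.sum_bij (fun σ _ l => e (σ l)) ?_ ?_ ?_ fun _ _ => rfl
  · intro σ _
    refine Finset.mem_filter.2 ⟨Fintype.mem_piFinset.2 fun l => hSR ?_, ?_⟩
    · rw [← himg]
      exact Finset.mem_image_of_mem _ (Finset.mem_univ _)
    · rw [← himg]
      ext a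
      simp only [Finset.mem_image, Finset.mem_univ, true_and]
      exact ⟨fun ⟨i, h⟩ => ⟨σ i, h⟩, fun ⟨i, h⟩ => ⟨σ.symm i, by rw [σ.apply_symm_apply, h]⟩⟩
  · intro σ _ τ _ h
    exact Equiv.ext fun l => he (congrFun h l)
  · intro f hf
    have hfS := (Finset.mem_filter.1 hf).2
    have hinj : Function.Injective f := by
      have h1 : (Finset.univ.image f).card = (Finset.univ : Finset (Fin n)).card := by
        rw [hfS, hcard, Finset.card_univ, Fintype.card_fin]
      exact fun a b h => Finset.card_image_iff.1 h1 (Finset.mem_coe.2 (Finset.mem_univ a))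
        (Finset.mem_coe.2 (Finset.mem_univ b)) h
    have h2 : ∀ l, ∃ i, e i = f l := by
      intro l
      have : f l ∈ Finset.univ.image e := by
        rw [himg, ← hfS]
        exact Finset.mem_image_of_mem _ (Finset.mem_univ _)
      obtain ⟨i, -, hi⟩ := Finset.mem_image.1 this
      exact ⟨i, hi⟩
    choose s hs using h2
    have hsinj : Function.Injective s := fun a b h => hinj (by rw [← hs, ← hs, h])
    exact ⟨Equiv.ofBijective s (Finite.injective_iff_bijective.1 hsinj), Finset.mem_univ _,
      funext hs⟩

/-- The Cauchy–Binet formula, with the index sets `S` enumerated by `e S`. -/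
theorem det_sum_mul {n : ℕ} (R : Finset ℕ) (φ ψ : Fin n → ℕ → ℝ) (e : Finset ℕ → Fin n → ℕ)
    (he : ∀ S ∈ Finset.powersetCard n R,
      Function.Injective (e S) ∧ Finset.univ.image (e S) = S) :
    Matrix.det (Matrix.of fun l l' => ∑ a ∈ R, φ l a * ψ l' a) =
      ∑ S ∈ Finset.powersetCard n R, Matrix.det (Matrix.of fun i l => φ l (e S i)) *
        Matrix.det (Matrix.of fun i l => ψ l (e S i)) := by
  set F : (Fin n → ℕ) → ℝ := fun f =>
    (∏ l, φ l (f l)) * Matrix.det (Matrix.of fun l l' => ψ l' (f l)) with hF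
  have h1 : Matrix.det (Matrix.of fun l l' => ∑ a ∈ R, φ l a * ψ l' a) =
      ∑ f ∈ Fintype.piFinset fun _ : Fin n => R, F f := by
    have := (Matrix.detRowAlternating (n := Fin n) (R := ℝ)).toMultilinearMap.map_sum_finset
      (fun l a => fun l' : Fin n => φ l a * ψ l' a) (fun _ : Fin n => R)
    refine Eq.trans ?_ (this.trans (Finset.sum_congr rfl fun f _ => ?_))
    · change Matrix.det _ = Matrix.det _
      congr 1
      ext l l'
      rw [Finset.sum_apply]
      rfl
    · rw [hF]
      dsimp only
      rw [← Matrix.det_mul_column]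
      rfl
  have h0 : ∀ S ∈ R.powerset, S ∉ Finset.powersetCard n R →
      ∑ f ∈ (Fintype.piFinset fun _ : Fin n => R).filter
        (fun f => Finset.univ.image f = S), F f = 0 := by
    intro S hS hS'
    refine Finset.sum_eq_zero fun f hf => ?_
    have hninj : ¬ Function.Injective f := fun hinj => hS' (Finset.mem_powersetCard.2
      ⟨Finset.mem_powerset.1 hS, by rw [← (Finset.mem_filter.1 hf).2,
        Finset.card_image_of_injective _ hinj, Finset.card_univ, Fintype.card_fin]⟩)
    simp only [Function.Injective, not_forall] at hninj
    obtain ⟨i, j, hij, hne⟩ := hninj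
    rw [hF]
    dsimp only
    rw [Matrix.det_zero_of_row_eq hne (by ext l; simp [hij]), mul_zero]
  have hmaps : ∀ f ∈ Fintype.piFinset fun _ : Fin n => R, Finset.univ.image f ∈ R.powerset := by
    intro f hf
    refine Finset.mem_powerset.2 fun a ha => ?_
    obtain ⟨i, -, rfl⟩ := Finset.mem_image.1 ha
    exact Fintype.mem_piFinset.1 hf i
  rw [h1, ← Finset.sum_fiberwise_of_maps_to hmaps, ← Finset.sum_subset
    (fun S hS => Finset.mem_powerset.2 (Finset.mem_powersetCard.1 hS).1) h0]
  refine Finset.sum_congr rfl fun S hS => ?_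
  rw [sum_filter_image_eq hS (he S hS).1 (he S hS).2, Matrix.det_apply', Finset.sum_mul]
  refine Finset.sum_congr rfl fun σ _ => ?_
  have h2 := Matrix.det_permute σ (Matrix.of fun i l => ψ l (e S i))
  rw [hF]
  dsimp only
  rw [show (Matrix.of fun l l' => ψ l' (e S (σ l))) =
    (Matrix.of fun i l => ψ l (e S i)).submatrix σ id from rfl, h2]
  simp only [Matrix.of_apply]
  ring

end CauchyBinet

/-! ### Diagrams in a box as configurations of points -/

section Configurations

variable {n k : ℕ}

theorem strictMono_add_le {e : Fin n → ℕ} (he : StrictMono e) {i j : Fin n} (hij : i ≤ j) :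
    e i + (j - i : ℕ) ≤ e j := by
  suffices h : ∀ d : ℕ, ∀ j : Fin n, (j : ℕ) = i + d → e i + d ≤ e j from
    h _ j (by have : (i : ℕ) ≤ j := hij; omega)
  intro d
  induction d with
  | zero => intro j hj; rw [show j = i from Fin.ext hj]; exact le_rfl
  | succ d ih =>
    intro j hj
    have h1 := ih ⟨i + d, by have := j.2; omega⟩ rfl
    have h2 : e ⟨i + d, by have := j.2; omega⟩ < e j :=
      he (show (i : ℕ) + d < j by omega)
    omega

/-- Diagrams in the box correspond to `n`-point configurations in `{0, …, n + k - 1}`. -/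
theorem bijective_pointSet (n k : ℕ) : Function.Bijective
    (fun lam : boxDiagrams n k =>
      (⟨pointSet n lam, Finset.mem_powersetCard.2 ⟨pointSet_subset lam.2, card_pointSet n _⟩⟩ :
        {S // S ∈ Finset.powersetCard n (Finset.range (n + k))})) := by
  constructor
  · rintro ⟨lam, hlam⟩ ⟨mu, hmu⟩ h
    have h1 : pointSet n lam = pointSet n mu := congrArg Subtype.val h
    rw [← image_point_rev, ← image_point_rev] at h1
    have h2 := congrArg (fun S : Finset ℕ => (S : Set ℕ)) h1
    simp only [Finset.coe_image, Finset.coe_univ, Set.image_univ] at h2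
    have h3 := (StrictMono.range_inj (strictMono_point_rev n lam)
      (strictMono_point_rev n mu)).1 h2
    refine Subtype.ext (YoungDiagram_ext_rowLen fun i => ?_)
    change lam.rowLen i = mu.rowLen i
    by_cases hi : i < n
    · have h4 := congrFun h3 (Fin.rev ⟨i, hi⟩)
      simp only [Fin.rev_rev, point] at h4
      omega
    · rw [rowLen_eq_zero (fun c hc => (hlam c hc).1) (not_lt.1 hi),
        rowLen_eq_zero (fun c hc => (hmu c hc).1) (not_lt.1 hi)]
  · rintro ⟨S, hS⟩
    obtain ⟨hSR, hcard⟩ := Finset.mem_powersetCard.1 hS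
    set e : Fin n → ℕ := ⇑(S.orderEmbOfFin hcard) with he
    have hmono : StrictMono e := (S.orderEmbOfFin hcard).strictMono
    have hmem : ∀ i, e i < n + k := fun i =>
      Finset.mem_range.1 (hSR (Finset.orderEmbOfFin_mem S hcard i))
    have hge : ∀ i : Fin n, (i : ℕ) ≤ e i := by
      intro i
      have h1 : (⟨0, by have := i.2; omega⟩ : Fin n) ≤ i := Nat.zero_le _
      have h2 := strictMono_add_le hmono h1
      simp only at h2
      omega
    have hle : ∀ i : Fin n, e i - i ≤ k := by
      intro i
      have h1 : i ≤ (⟨n - 1, by have := i.2; omega⟩ : Fin n) := by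
        have := i.2
        exact show (i : ℕ) ≤ n - 1 by omega
      have h2 := strictMono_add_le hmono h1
      have h3 := hmem ⟨n - 1, by have := i.2; omega⟩
      simp only at h2 h3
      omega
    set b : Fin n → ℕ := fun i => e i.rev - (i.rev : ℕ) with hb
    have hanti : Antitone b := by
      intro i j hij
      have h1 := strictMono_add_le hmono (Fin.rev_le_rev.2 hij)
      have h2 : (j.rev : ℕ) ≤ i.rev := Fin.rev_le_rev.2 hij
      simp only [hb]
      omega
    refine ⟨⟨ofRows b, ?_⟩, Subtype.ext ?_⟩
    · rintro ⟨i, j⟩ hc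
      obtain ⟨h1, h2⟩ := mem_ofRows.1 hc
      exact ⟨h1, (h2 ⟨i, h1⟩ le_rfl).trans_le (hle _)⟩
    · have h1 : (fun i : Fin n => point n (ofRows b) i.rev) = e := by
        funext i
        rw [point, rowLen_ofRows hanti, hb]
        have h2 := hge i
        have := i.2
        simp only [Fin.rev_rev, Fin.val_rev]
        omega
      change pointSet n (ofRows b) = S
      rw [← image_point_rev, h1, he, ← Finset.coe_inj, Finset.coe_image, Finset.coe_univ,
        Set.image_univ, Finset.range_orderEmbOfFin]

end Configurations

/-! ### The `q`-Krawtchouk ensemble -/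

section Ensemble

variable {q p : ℝ}

/-- The probability of the configuration `S` in the ensemble of the first `n` `q`-Krawtchouk
polynomials. -/
noncomputable def ensembleMass (p : ℝ) (N : ℕ) (q : ℝ) (n : ℕ) (S : Finset ℕ) : ℝ :=
  (∏ a ∈ S, qKrawtchoukWeight p N q a) * vProd q⁻¹ S ^ 2 /
    ∏ l ∈ Finset.range n, monicNormSq p N q l

theorem det_cdKernel_of_strictMono (hq0 : 0 < q) (hq1 : q ≠ 1) (hp : 0 < p) {n N : ℕ}
    (hn : n ≤ N + 1) {f : Fin n → ℕ} (hf : StrictMono f) :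
    Matrix.det (Matrix.of fun i j : Fin n =>
        cdKernel (qKrawtchoukWeight p N q) p N q n (f i) (f j)) =
      ensembleMass p N q n (Finset.univ.image f) := by
  have h : (fun i => q ^ (-(f i : ℤ))) = fun i => q⁻¹ ^ f i := by
    funext i
    rw [zpow_neg, zpow_natCast, inv_pow]
  rw [det_cdKernel hq0 hq1 hp hn, ensembleMass, h, ← sq_abs, abs_det_vandermonde _ hf,
    Finset.prod_image hf.injective.injOn]

theorem det_cdKernel_point (hq0 : 0 < q) (hq1 : q ≠ 1) (hp : 0 < p) {n N : ℕ}
    (hn : n ≤ N + 1) (lam : YoungDiagram) :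
    Matrix.det (Matrix.of fun i j : Fin n =>
        cdKernel (qKrawtchoukWeight p N q) p N q n (point n lam i) (point n lam j)) =
      ensembleMass p N q n (pointSet n lam) := by
  rw [← image_point_rev, ← det_cdKernel_of_strictMono hq0 hq1 hp hn (strictMono_point_rev n lam),
    ← Matrix.det_submatrix_equiv_self Fin.revPerm]
  rfl

/-- The masses sum to one: this is the Cauchy–Binet formula for the Gram matrix of the first `n`
orthonormal functions. -/
theorem sum_ensembleMass (hq0 : 0 < q) (hq1 : q ≠ 1) (hp : 0 < p) {n N : ℕ}
    (hn : n ≤ N + 1) :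
    ∑ S ∈ Finset.powersetCard n (Finset.range (N + 1)), ensembleMass p N q n S = 1 := by
  set φ : Fin n → ℕ → ℝ := fun l a =>
    Real.sqrt (qKrawtchoukWeight p N q a) * normQKrawtchouk l p N q a with hφ
  have hw := fun x => qKrawtchoukWeight_pos hq0 hq1 hp N x
  set e : Finset ℕ → Fin n → ℕ := fun S i =>
    if h : S.card = n then S.orderEmbOfFin h i else 0 with he
  have heS : ∀ S ∈ Finset.powersetCard n (Finset.range (N + 1)),
      StrictMono (e S) ∧ Finset.univ.image (e S) = S := by
    intro S hS
    have hcard := (Finset.mem_powersetCard.1 hS).2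
    have h1 : e S = S.orderEmbOfFin hcard := funext fun i => dif_pos hcard
    rw [h1]
    refine ⟨(S.orderEmbOfFin hcard).strictMono, ?_⟩
    rw [← Finset.coe_inj, Finset.coe_image, Finset.coe_univ, Set.image_univ,
      Finset.range_orderEmbOfFin]
  have hgram : (Matrix.of fun l l' : Fin n => ∑ a ∈ Finset.range (N + 1), φ l a * φ l' a) = 1 := by
    ext l l'
    have h1 := normQKrawtchouk_orthonormal hq0 hq1 hp (j := l) (l := l') (N := N)
      (by have := l.2; omega) (by have := l'.2; omega)
    rw [Matrix.of_apply, Matrix.one_apply]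
    refine Eq.trans ?_ (h1.trans (if_congr Fin.ext_iff.symm rfl rfl))
    refine Finset.sum_congr rfl fun a _ => ?_
    have := Real.mul_self_sqrt (hw a).le
    simp only [hφ]
    linear_combination (normQKrawtchouk l p N q a * normQKrawtchouk l' p N q a) * this
  have hCB := det_sum_mul (Finset.range (N + 1)) φ φ e
    fun S hS => ⟨(heS S hS).1.injective, (heS S hS).2⟩
  rw [hgram, Matrix.det_one] at hCB
  rw [hCB]
  refine Finset.sum_congr rfl fun S hS => ?_
  nth_rewrite 1 [← (heS S hS).2]
  rw [← det_cdKernel_of_strictMono hq0 hq1 hp hn (heS S hS).1]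
  have hsq : Matrix.det (Matrix.of fun i l => φ l (e S i)) *
        Matrix.det (Matrix.of fun i l => φ l (e S i)) =
      Matrix.det ((Matrix.of fun i l => φ l (e S i)) *
        (Matrix.of fun i l => φ l (e S i)).transpose) := by
    rw [Matrix.det_mul, Matrix.det_transpose]
  rw [hsq]
  congr 1
  ext i j
  rw [Matrix.mul_apply, Matrix.of_apply, cdKernel, Real.sqrt_mul (hw _).le, Finset.sum_range,
    Finset.mul_sum]
  refine Finset.sum_congr rfl fun l _ => ?_
  simp only [Matrix.transpose_apply, Matrix.of_apply, hφ]
  ring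

theorem hasSum_ensembleMass (hq0 : 0 < q) (hq1 : q ≠ 1) (hp : 0 < p) (n K : ℕ) :
    HasSum (fun lam : boxDiagrams n (K + 1) => ensembleMass p (n + K) q n (pointSet n lam)) 1 := by
  have h1 := sum_ensembleMass hq0 hq1 hp (n := n) (N := n + K) (by omega)
  rw [add_assoc] at h1
  have h2 := hasSum_fintype fun S : {S // S ∈ Finset.powersetCard n (Finset.range (n + (K + 1)))} =>
    ensembleMass p (n + K) q n S
  rw [Finset.sum_coe_sort (Finset.powersetCard n (Finset.range (n + (K + 1))))
    (ensembleMass p (n + K) q n), h1] at h2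
  obtain ⟨E, hE⟩ : ∃ E : boxDiagrams n (K + 1) ≃
      {S // S ∈ Finset.powersetCard n (Finset.range (n + (K + 1)))},
      ∀ lam, (E lam : Finset ℕ) = pointSet n lam :=
    ⟨Equiv.ofBijective _ (bijective_pointSet n (K + 1)), fun _ => rfl⟩
  have h3 := E.hasSum_iff.2 h2
  rw [show ((fun S : {S // S ∈ Finset.powersetCard n (Finset.range (n + (K + 1)))} =>
      ensembleMass p (n + K) q n S) ∘ E) = fun lam : boxDiagrams n (K + 1) =>
        ensembleMass p (n + K) q n (pointSet n lam) from
    funext fun lam => congrArg (ensembleMass p (n + K) q n) (hE lam)] at h3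
  exact h3

end Ensemble

/-! ### The two principal specializations -/

section Measures

variable {q : ℝ} {n k K : ℕ} {lam : YoungDiagram}

theorem characterMeasure_nonneg {x : Fin n → ℝ} {y : Fin k → ℝ} (hx : ∀ i, 0 ≤ x i)
    (hy : ∀ j, 0 ≤ y j) (lam : YoungDiagram) : 0 ≤ characterMeasure x y lam :=
  div_nonneg (mul_nonneg (schur_nonneg _ hx) (schur_nonneg _ hy))
    (Finset.prod_nonneg fun i _ => Finset.prod_nonneg fun j _ => add_nonneg (hx i) (hy j))

theorem measureQ_eq_characterMeasure (q : ℝ) (hlam : lam ∈ boxDiagrams n k) :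
    measureQ n k q lam =
      characterMeasure (fun i : Fin n => q ^ (i : ℕ)) (fun j : Fin k => q ^ (j : ℕ)) lam := by
  rw [measureQ, characterMeasure, pow_rowNorm_mul_qDim fun c hc => (hlam c hc).1,
    pow_rowNorm_mul_qDim fun c hc => (complConj_mem_box c hc).1]

theorem measureQInv_eq_characterMeasure (q : ℝ) (hlam : lam ∈ boxDiagrams n k) :
    measureQInv n k q lam =
      characterMeasure (fun i : Fin n => q ^ (i : ℕ))
        (fun j : Fin k => q ^ (-((j : ℕ) : ℤ))) lam := by
  have h : (fun j : Fin k => q ^ (-((j : ℕ) : ℤ))) = fun j : Fin k => (1 / q) ^ (j : ℕ) := by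
    funext j
    rw [zpow_neg, zpow_natCast, one_div, inv_pow]
  have h2 : q ^ (-(rowNorm k (complConj n k lam) : ℤ)) =
      (1 / q) ^ rowNorm k (complConj n k lam) := by
    rw [zpow_neg, zpow_natCast, one_div, inv_pow]
  rw [measureQInv, h2, pow_rowNorm_mul_qDim fun c hc => (hlam c hc).1,
    pow_rowNorm_mul_qDim fun c hc => (complConj_mem_box c hc).1, characterMeasure, h]

theorem weightQ_eq (hq0 : 0 < q) (n K : ℕ) :
    weightQ n (K + 1) q = qKrawtchoukWeight (q ^ (1 - 2 * (n : ℤ))) (n + K) q := by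
  funext a
  rw [weightQ, qKrawtchoukWeight, mul_comm, mul_assoc, ← zpow_mul, ← zpow_add₀ hq0.ne']
  congr 2
  push_cast
  ring

theorem weightQInv_eq (hq0 : 0 < q) (n K : ℕ) :
    weightQInv n (K + 1) q = qKrawtchoukWeight (q ^ (1 - 2 * (n : ℤ) - K)) (n + K) q := by
  funext a
  rw [weightQInv, qKrawtchoukWeight, mul_comm, mul_assoc, ← zpow_mul, ← zpow_add₀ hq0.ne']
  congr 2
  push_cast
  ring

theorem prod_monicNormSq_pos (hq0 : 0 < q) (hq1 : q ≠ 1) {p : ℝ} (hp : 0 < p) (n K : ℕ) :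
    0 < ∏ l ∈ Finset.range n, monicNormSq p (n + K) q l :=
  Finset.prod_pos fun l hl => monicNormSq_pos hq0 hq1 hp (by
    have := Finset.mem_range.1 hl; omega)

theorem characterMeasure_self_eq (hq0 : 0 < q) (hq1 : q ≠ 1)
    (hlam : lam ∈ boxDiagrams n (K + 1)) :
    characterMeasure (fun i : Fin n => q ^ (i : ℕ)) (fun j : Fin (K + 1) => q ^ (j : ℕ)) lam =
      ensembleMass (q ^ (1 - 2 * (n : ℤ))) (n + K) q n (pointSet n lam) := by
  have hSR : pointSet n lam ⊆ Finset.range (n + K + 1) := pointSet_subset hlam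
  have hη := prod_monicNormSq_pos hq0 hq1 (p := q ^ (1 - 2 * (n : ℤ))) (zpow_pos hq0 _) n K
  have hc := congrArg abs (prod_monicNormSq_self hq0 hq1 n K)
  have hZ : 0 < ∏ i : Fin n, ∏ j : Fin (K + 1), (q ^ (i : ℕ) + q ^ (j : ℕ)) :=
    Finset.prod_pos fun i _ => Finset.prod_pos fun j _ => by positivity
  rw [Finset.prod_mul_distrib, abs_mul, abs_of_pos hη, abs_of_pos hZ] at hc
  rw [characterMeasure, schur_geometric hq0 hq1 fun c hc => (hlam c hc).1,
    schur_geometric hq0 hq1 fun c hc => (complConj_mem_box c hc).1, pointSet_complConj hlam,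
    show n + (K + 1) = n + K + 1 from rfl,
    vProd_mul_vProd_sdiff hq0 hq1 hSR (card_pointSet n lam), ensembleMass,
    ← weightQ_eq hq0, ← hc]
  rw [← hc] at hZ
  have hA := (pos_iff_pos_of_mul_pos hZ).1 hη
  generalize |∏ l ∈ Finset.range n, (q ^ (((n + K - l).choose 2 : ℤ) - l.choose 2) *
          (qPoch q q (n + K - l) / (qPoch q q l * qPoch q q (n + K))))| = A at *
  field_simp

theorem characterMeasure_inv_eq (hq0 : 0 < q) (hq1 : q ≠ 1)
    (hlam : lam ∈ boxDiagrams n (K + 1)) :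
    characterMeasure (fun i : Fin n => q ^ (i : ℕ))
        (fun j : Fin (K + 1) => q ^ (-((j : ℕ) : ℤ))) lam =
      ensembleMass (q ^ (1 - 2 * (n : ℤ) - K)) (n + K) q n (pointSet n lam) := by
  have hq := hq0.ne'
  have hy : (fun j : Fin (K + 1) => q ^ (-((j : ℕ) : ℤ))) =
      fun j : Fin (K + 1) => q⁻¹ ^ (j : ℕ) := by
    funext j
    rw [zpow_neg, zpow_natCast, inv_pow]
  have hη := prod_monicNormSq_pos hq0 hq1 (p := q ^ (1 - 2 * (n : ℤ) - K)) (zpow_pos hq0 _) n K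
  have hc := congrArg abs (prod_monicNormSq_inv hq0 hq1 n K)
  have hZ : 0 < ∏ i : Fin n, ∏ j : Fin (K + 1), (q ^ (i : ℕ) + q ^ (-((j : ℕ) : ℤ))) :=
    Finset.prod_pos fun i _ => Finset.prod_pos fun j _ => by positivity
  have hsplit : ∀ l ∈ Finset.range n,
      q ^ (((n + K - l).choose 2 : ℤ) - l.choose 2 - K * (l + K + 1)) *
          (qPoch q q (n + K - l) / (qPoch q q l * qPoch q q (n + K))) =
        q ^ (-(K * (l + K + 1) : ℤ)) * (q ^ (((n + K - l).choose 2 : ℤ) - l.choose 2) *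
          (qPoch q q (n + K - l) / (qPoch q q l * qPoch q q (n + K)))) := by
    intro l _
    rw [← mul_assoc, ← zpow_add₀ hq]
    congr 2
    ring
  have hE : 0 < ∏ l ∈ Finset.range n, q ^ (-(K * (l + K + 1) : ℤ)) :=
    Finset.prod_pos fun _ _ => zpow_pos hq0 _
  rw [Finset.prod_mul_distrib, Finset.prod_congr rfl hsplit, Finset.prod_mul_distrib, abs_mul,
    abs_mul, abs_of_pos hη, abs_of_pos hZ, abs_of_pos hE] at hc
  set S := pointSet n lam with hS
  have hSR := pointSet_subset hlam
  have hcardS := card_pointSet n lam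
  rw [← hS] at hSR hcardS
  have hcardT : (Finset.range (n + (K + 1)) \ S).card = K + 1 := by
    rw [Finset.card_sdiff_of_subset hSR, hcardS, Finset.card_range]
    omega
  -- The powers of `q` over the holes, in terms of the powers over the points.
  have hpow : (∏ b ∈ Finset.range (n + (K + 1)) \ S, q ^ (-(K * b : ℤ))) =
      (∏ b ∈ Finset.range (K + 1), q ^ (-(K * b : ℤ))) *
        (∏ l ∈ Finset.range n, q ^ (-(K * (l + K + 1) : ℤ))) * ∏ a ∈ S, q ^ (K * a : ℤ) := by
    have h1 := Finset.prod_sdiff hSR (f := fun b : ℕ => q ^ (-(K * b : ℤ)))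
    rw [add_comm n, Finset.prod_range_add] at h1
    have h2 : (∏ a ∈ S, q ^ (-(K * a : ℤ))) * ∏ a ∈ S, q ^ (K * a : ℤ) = 1 := by
      rw [← Finset.prod_mul_distrib]
      exact Finset.prod_eq_one fun a _ => by rw [← zpow_add₀ hq, neg_add_cancel, zpow_zero]
    have h3 : ∏ l ∈ Finset.range n, q ^ (-(K * ((K + 1 + l : ℕ) : ℤ)) : ℤ) =
        ∏ l ∈ Finset.range n, q ^ (-(K * (l + K + 1) : ℤ)) :=
      Finset.prod_congr rfl fun l _ => by congr 1; push_cast; ring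
    rw [h3] at h1
    rw [← h1, add_comm (K + 1) n, mul_assoc, h2, mul_one]
  have hW : ∏ a ∈ S, weightQInv n (K + 1) q a =
      (∏ a ∈ S, weightQ n (K + 1) q a) * ∏ a ∈ S, q ^ (K * a : ℤ) := by
    rw [← Finset.prod_mul_distrib]
    refine Finset.prod_congr rfl fun a _ => ?_
    rw [weightQ, weightQInv, mul_right_comm, ← zpow_add₀ hq]
    congr 2
    push_cast
    ring
  have hT : vProd q⁻¹ (Finset.range (n + (K + 1)) \ S) / vProd q⁻¹ (Finset.range (K + 1)) =
      vProd q (Finset.range (n + (K + 1)) \ S) / vProd q (Finset.range (K + 1)) *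
        ((∏ l ∈ Finset.range n, q ^ (-(K * (l + K + 1) : ℤ))) * ∏ a ∈ S, q ^ (K * a : ℤ)) := by
    rw [vProd_inv hq0, vProd_inv hq0, hcardT, Finset.card_range]
    push_cast
    rw [add_sub_cancel_right, hpow]
    have h1 : 0 < ∏ b ∈ Finset.range (K + 1), q ^ (-(K * b : ℤ)) :=
      Finset.prod_pos fun _ _ => zpow_pos hq0 _
    have h2 := vProd_pos hq0 hq1 (Finset.range (K + 1))
    generalize ∏ b ∈ Finset.range (K + 1), q ^ (-(K * b : ℤ)) = X at *
    field_simp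
  have hbase := vProd_mul_vProd_sdiff hq0 hq1 hSR hcardS
  rw [characterMeasure, hy, schur_geometric hq0 hq1 fun c hc => (hlam c hc).1,
    schur_geometric (inv_pos.2 hq0) (by rwa [ne_eq, inv_eq_one])
      fun c hc => (complConj_mem_box c hc).1, pointSet_complConj hlam, ← hS, hT, ← mul_assoc,
    show n + (K + 1) = n + K + 1 from rfl, hbase, ensembleMass, ← weightQInv_eq hq0, hW]
  rw [← hc]
  rw [← hc] at hZ
  have hA := (pos_iff_pos_of_mul_pos ((mul_pos_iff_of_pos_left hη).1 hZ)).1 hE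
  generalize |∏ l ∈ Finset.range n, (q ^ (((n + K - l).choose 2 : ℤ) - l.choose 2) *
          (qPoch q q (n + K - l) / (qPoch q q l * qPoch q q (n + K))))| = A at *
  field_simp

end Measures

end SkewHowe

/-- For each of the two measures: it is the stated specialization of the character measure; it is a
probability measure on the diagrams in the box; it is the determinant of the Christoffel–Darboux
kernel; and the polynomials in the kernel are orthonormal for the weight in the kernel. -/
theorem theorem1 (n k : ℕ) (hn : 1 ≤ n) (hk : 1 ≤ k) (q : ℝ) (hq0 : 0 < q) (hq1 : q ≠ 1) :
    ((∀ lam ∈ boxDiagrams n k,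
        measureQ n k q lam =
          characterMeasure (fun i : Fin n => q ^ (i : ℕ)) (fun j : Fin k => q ^ (j : ℕ)) lam) ∧
      (∀ lam ∈ boxDiagrams n k, 0 ≤ measureQ n k q lam) ∧
      HasSum (fun lam : boxDiagrams n k => measureQ n k q lam) 1 ∧
      (∀ lam ∈ boxDiagrams n k,
        measureQ n k q lam =
          Matrix.det (Matrix.of fun i j : Fin n =>
            cdKernel (weightQ n k q) (q ^ (1 - 2 * (n : ℤ))) (n + k - 1) q n
              (point n lam i) (point n lam j))) ∧
      (∀ j ≤ n + k - 1, ∀ l ≤ n + k - 1,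
        ∑ a ∈ Finset.range (n + k), weightQ n k q a *
          normQKrawtchouk j (q ^ (1 - 2 * (n : ℤ))) (n + k - 1) q a *
          normQKrawtchouk l (q ^ (1 - 2 * (n : ℤ))) (n + k - 1) q a =
            if j = l then 1 else 0)) ∧
    ((∀ lam ∈ boxDiagrams n k,
        measureQInv n k q lam =
          characterMeasure (fun i : Fin n => q ^ (i : ℕ))
            (fun j : Fin k => q ^ (-((j : ℕ) : ℤ))) lam) ∧
      (∀ lam ∈ boxDiagrams n k, 0 ≤ measureQInv n k q lam) ∧
      HasSum (fun lam : boxDiagrams n k => measureQInv n k q lam) 1 ∧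
      (∀ lam ∈ boxDiagrams n k,
        measureQInv n k q lam =
          Matrix.det (Matrix.of fun i j : Fin n =>
            cdKernel (weightQInv n k q) (q ^ (2 - 2 * (n : ℤ) - (k : ℤ))) (n + k - 1) q n
              (point n lam i) (point n lam j))) ∧
      (∀ j ≤ n + k - 1, ∀ l ≤ n + k - 1,
        ∑ a ∈ Finset.range (n + k), weightQInv n k q a *
          normQKrawtchouk j (q ^ (2 - 2 * (n : ℤ) - (k : ℤ))) (n + k - 1) q a *
          normQKrawtchouk l (q ^ (2 - 2 * (n : ℤ) - (k : ℤ))) (n + k - 1) q a =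
            if j = l then 1 else 0)) := by

  obtain ⟨K, rfl⟩ : ∃ K, k = K + 1 := ⟨k - 1, by omega⟩
  have hN : n + (K + 1) - 1 = n + K := rfl
  have hR : Finset.range (n + (K + 1)) = Finset.range (n + K + 1) := rfl
  have hp : (2 : ℤ) - 2 * n - ((K + 1 : ℕ) : ℤ) = 1 - 2 * n - K := by push_cast; ring
  have hp1 : 0 < q ^ (1 - 2 * (n : ℤ)) := zpow_pos hq0 _
  have hp2 : 0 < q ^ (1 - 2 * (n : ℤ) - K) := zpow_pos hq0 _
  have hm1 : ∀ lam ∈ boxDiagrams n (K + 1), measureQ n (K + 1) q lam =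
      ensembleMass (q ^ (1 - 2 * (n : ℤ))) (n + K) q n (pointSet n lam) := fun lam hlam =>
    (measureQ_eq_characterMeasure q hlam).trans (characterMeasure_self_eq hq0 hq1 hlam)
  have hm2 : ∀ lam ∈ boxDiagrams n (K + 1), measureQInv n (K + 1) q lam =
      ensembleMass (q ^ (1 - 2 * (n : ℤ) - K)) (n + K) q n (pointSet n lam) := fun lam hlam =>
    (measureQInv_eq_characterMeasure q hlam).trans (characterMeasure_inv_eq hq0 hq1 hlam)
  rw [hN, hR, hp, weightQ_eq hq0, weightQInv_eq hq0]
  refine ⟨⟨fun lam hlam => measureQ_eq_characterMeasure q hlam, fun lam hlam => ?_, ?_,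
    fun lam hlam => ?_, fun j hj l hl => normQKrawtchouk_orthonormal hq0 hq1 hp1 hj hl⟩,
    ⟨fun lam hlam => measureQInv_eq_characterMeasure q hlam, fun lam hlam => ?_, ?_,
    fun lam hlam => ?_, fun j hj l hl => normQKrawtchouk_orthonormal hq0 hq1 hp2 hj hl⟩⟩
  · rw [measureQ_eq_characterMeasure q hlam]
    exact characterMeasure_nonneg (fun _ => by positivity) (fun _ => by positivity) lam
  · rw [show (fun lam : boxDiagrams n (K + 1) => measureQ n (K + 1) q lam) =
        fun lam : boxDiagrams n (K + 1) =>
      ensembleMass (q ^ (1 - 2 * (n : ℤ))) (n + K) q n (pointSet n lam) from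
        funext fun lam => hm1 lam lam.2]
    exact hasSum_ensembleMass hq0 hq1 hp1 n K
  · rw [hm1 lam hlam, det_cdKernel_point hq0 hq1 hp1 (by omega)]
  · rw [measureQInv_eq_characterMeasure q hlam]
    exact characterMeasure_nonneg (fun _ => by positivity) (fun _ => by positivity) lam
  · rw [show (fun lam : boxDiagrams n (K + 1) => measureQInv n (K + 1) q lam) =
        fun lam : boxDiagrams n (K + 1) =>
      ensembleMass (q ^ (1 - 2 * (n : ℤ) - K)) (n + K) q n (pointSet n lam) from
        funext fun lam => hm2 lam lam.2]
    exact hasSum_ensembleMass hq0 hq1 hp2 n K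
  · rw [hm2 lam hlam, det_cdKernel_point hq0 hq1 hp2 (by omega)]
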